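/- For a natural number $N\ge 1$ put $Z_N=\{0,1,\dots,N-1\}$, let $d\ge 1$ be a natural number, and let $b_1,\dots,b_d$ and $s_1,\dots,s_d$ be elements of $Z_N$. We say that these two families are a *solution* for $N$ if the sets $\{b_n:1\le n\le d\}$ and $\{s_n:1\le n\le d\}$ are disjoint and, in case $N$ is composite, there are $i,j\in\{1,\dots,d\}$ and a prime factor $p$ of $N$ with $b_i\equiv s_j \pmod p$. Consider the following algorithm with the linear polynomials $f_n:=X-b_n$. 1. Compute the coefficients modulo $N$ of the polynomial $g:=\prod_{n=1}^d f_n \bmod N$. 2. For $n=1,\dots,d$ compute $y_n:=g(s_n)\bmod N$. 3. Start with $j:=1$. 4. If $j>d$, print 'Error A' and stop. Otherwise compute $G_j:=\gcd(y_j,N)$. If $G_j=1$, replace $j$ by $j+1$ and repeat Step 4. If $1<G_j<N$, print $G_j$ and stop. If $G_j=N$, go to Step 5. 5. Start with $i:=1$. 6. If $i>d$, print 'Error B' and stop. Otherwise compute $H_i:=\gcd(f_i(s_j),N)$. If $H_i=1$ or $H_i=N$, replace $i$ by $i+1$ and repeat Step 6. If $1<H_i<N$, print $H_i$ and stop. Running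 time is measured in unit-cost operations: an addition, subtraction or multiplication modulo $N$, a gcd of a residue with $N$, an equality test of two residues, the construction or inspection of a pair (lists are built from pairs), a variable access or local definition, and a function call each cost one operation. A program is a finite table of mutually recursive first-order functions over these operations together with a main expression, and does not depend on $N$, $d$ or the input. **Theorem.** (a) There is one program which, for all $N,d\ge1$ and all $b_n,s_n\in Z_N$, carries out the algorithm, that is, computes from the lists of the $b_n$ and of the $s_n$ the coefficients of $g$ modulo $N$, the values $y_1,\dots,y_d$ and the printed output, and which runs in $\mathcal O(d^{1+\epsilon})$ operations if the families are a solution: for every $\epsilon>0$ there is a constant $C$, depending only on $\epsilon$, such that for all $N$, all $d\ge 1$ and all solutions $b_1,\dots,b_d$, $s_1,\dots,s_d$ for $N$ it takes at most $C\,d^{1+\epsilon}$ operations. (b) If $b_1,\dots,b_d$ and $s_1,\dots,s_d$ are a solution for $N$, then the algorithm prints a nontrivial factor of $N$ (a divisor $k$ of $N$ with $1<k<N$) if $N$ is composite, and it prints 'Error A' if $N$ is prime. -/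

import Mathlib

open Polynomial

namespace DigitFactor

/-- `N` is composite. -/
def IsComposite (N : ℕ) : Prop := 1 < N ∧ ¬ N.Prime

/-- The families `b_1, …, b_d` and `s_1, …, s_d` solve the problem for `N`: they lie in
`Z_N = {0, …, N - 1}`, the sets of their values are disjoint, and if `N` is composite then
some `b_i` and some `s_j` are congruent modulo a prime factor of `N`. -/
structure IsSolution (N : ℕ) {d : ℕ} (b s : Fin d → ℕ) : Prop where
  base_lt : ∀ n, b n < N
  point_lt : ∀ n, s n < N
  disjoint : Disjoint (Set.range b) (Set.range s)
  congr : IsComposite N → ∃ (i j : Fin d) (p : ℕ), p.Prime ∧ p ∣ N ∧ b i ≡ s j [MOD p]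

/-! ### The factoring algorithm -/

/-- What the algorithm prints. -/
inductive Output where
  | factor (k : ℕ)
  | errorA
  | errorB

section Algorithm

variable (N : ℕ) {d : ℕ} (f : Fin d → ℤ[X]) (s : Fin d → ℕ)

/-- Step 1: the polynomial `g = ∏ f_n`, reduced modulo `N`. -/
noncomputable def gPoly : (ZMod N)[X] :=
  ∏ n, (f n).map (Int.castRingHom (ZMod N))

/-- Step 2: the value `y_n = g(s_n) mod N`. -/
noncomputable def yValue (n : Fin d) : ZMod N :=
  (gPoly N f).eval (s n : ZMod N)

/-- Steps 5 and 6 at the point `x`, from the (zero-based) index `i` on. -/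
noncomputable def step6 (x : ℤ) (i : ℕ) : Output :=
  if h : i < d then
    let H := Int.gcd ((f ⟨i, h⟩).eval x) N
    if H = 1 ∨ H = N then step6 x (i + 1) else Output.factor H
  else Output.errorB
termination_by d - i

/-- Steps 3 and 4, from the (zero-based) index `j` on. -/
noncomputable def step4 (j : ℕ) : Output :=
  if h : j < d then
    let G := Nat.gcd (yValue N f s ⟨j, h⟩).val N
    if G = 1 then step4 (j + 1)
    else if G = N then step6 N f (s ⟨j, h⟩ : ℤ) 0
    else Output.factor G
  else Output.errorA
termination_by d - j

/-- The output of the algorithm on `N`, the polynomials `f_1, …, f_d` and the points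
`s_1, …, s_d`. -/
noncomputable def output : Output := step4 N f s 0

end Algorithm

/-- The linear polynomials `X - b_n`. -/
noncomputable def linearPolys {d : ℕ} (b : Fin d → ℕ) : Fin d → ℤ[X] :=
  fun n => X - C (b n : ℤ)

/-! ### The cost model

A first-order call-by-value functional language. Data are residues modulo `N`, the empty list
`nil`, and pairs `cons x y`. A program is a finite table of (mutually recursive) functions of one
argument together with a main expression; it does not depend on the input or on `N`. The
evaluation of every single expression node is one step. So an arithmetic operation modulo `N`, a
gcd with `N`, an equality test of residues, the construction or inspection of a pair, and a
function call are unit-cost operations, and nothing is free of charge. -/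

/-- Data. -/
inductive Val (N : ℕ) where
  | num (a : ZMod N)
  | nil
  | cons (x y : Val N)

/-- Expressions, with de Bruijn indices for variables. -/
inductive Expr where
  /-- the variable with the given index -/
  | var (i : ℕ)
  /-- a fixed numeral, read modulo `N` -/
  | lit (c : ℕ)
  /-- sum, difference and product modulo `N` -/
  | add (e₁ e₂ : Expr)
  | sub (e₁ e₂ : Expr)
  | mul (e₁ e₂ : Expr)
  /-- the greatest common divisor with `N`, read modulo `N` -/
  | gcd (e : Expr)
  /-- the branch `e₃` if the residues `e₁` and `e₂` are equal, and `e₄` otherwise -/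
  | ifEq (e₁ e₂ e₃ e₄ : Expr)
  | nil
  | cons (e₁ e₂ : Expr)
  /-- the branch `e₁` if `e` is `nil`; the branch `e₂`, with the head as variable `0` and the tail
  as variable `1`, if `e` is a pair -/
  | caseList (e e₁ e₂ : Expr)
  /-- evaluate `e₂` with the value of `e₁` as variable `0` -/
  | letIn (e₁ e₂ : Expr)
  /-- call the function number `k` of the program -/
  | call (k : ℕ) (e : Expr)

/-- `Eval N F ρ e v t`: with the function table `F`, modulo `N` and in the environment `ρ`, the
expression `e` evaluates to `v` in exactly `t` steps. -/
inductive Eval (N : ℕ) (F : List Expr) : List (Val N) → Expr → Val N → ℕ → Prop where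
  | var {ρ : List (Val N)} {i : ℕ} {v : Val N} :
      ρ[i]? = some v → Eval N F ρ (Expr.var i) v 1
  | lit {ρ : List (Val N)} {c : ℕ} :
      Eval N F ρ (Expr.lit c) (Val.num (c : ZMod N)) 1
  | add {ρ : List (Val N)} {e₁ e₂ : Expr} {a₁ a₂ : ZMod N} {t₁ t₂ : ℕ} :
      Eval N F ρ e₁ (Val.num a₁) t₁ → Eval N F ρ e₂ (Val.num a₂) t₂ →
      Eval N F ρ (Expr.add e₁ e₂) (Val.num (a₁ + a₂)) (t₁ + t₂ + 1)
  | sub {ρ : List (Val N)} {e₁ e₂ : Expr} {a₁ a₂ : ZMod N} {t₁ t₂ : ℕ} :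
      Eval N F ρ e₁ (Val.num a₁) t₁ → Eval N F ρ e₂ (Val.num a₂) t₂ →
      Eval N F ρ (Expr.sub e₁ e₂) (Val.num (a₁ - a₂)) (t₁ + t₂ + 1)
  | mul {ρ : List (Val N)} {e₁ e₂ : Expr} {a₁ a₂ : ZMod N} {t₁ t₂ : ℕ} :
      Eval N F ρ e₁ (Val.num a₁) t₁ → Eval N F ρ e₂ (Val.num a₂) t₂ →
      Eval N F ρ (Expr.mul e₁ e₂) (Val.num (a₁ * a₂)) (t₁ + t₂ + 1)
  | gcd {ρ : List (Val N)} {e : Expr} {a : ZMod N} {t : ℕ} :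
      Eval N F ρ e (Val.num a) t →
      Eval N F ρ (Expr.gcd e) (Val.num ((Nat.gcd a.val N : ℕ) : ZMod N)) (t + 1)
  | ifEq_true {ρ : List (Val N)} {e₁ e₂ e₃ e₄ : Expr} {a₁ a₂ : ZMod N} {v : Val N}
      {t₁ t₂ t₃ : ℕ} :
      Eval N F ρ e₁ (Val.num a₁) t₁ → Eval N F ρ e₂ (Val.num a₂) t₂ → a₁ = a₂ →
      Eval N F ρ e₃ v t₃ →
      Eval N F ρ (Expr.ifEq e₁ e₂ e₃ e₄) v (t₁ + t₂ + t₃ + 1)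
  | ifEq_false {ρ : List (Val N)} {e₁ e₂ e₃ e₄ : Expr} {a₁ a₂ : ZMod N} {v : Val N}
      {t₁ t₂ t₄ : ℕ} :
      Eval N F ρ e₁ (Val.num a₁) t₁ → Eval N F ρ e₂ (Val.num a₂) t₂ → a₁ ≠ a₂ →
      Eval N F ρ e₄ v t₄ →
      Eval N F ρ (Expr.ifEq e₁ e₂ e₃ e₄) v (t₁ + t₂ + t₄ + 1)
  | nil {ρ : List (Val N)} :
      Eval N F ρ Expr.nil Val.nil 1
  | cons {ρ : List (Val N)} {e₁ e₂ : Expr} {v₁ v₂ : Val N} {t₁ t₂ : ℕ} :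
      Eval N F ρ e₁ v₁ t₁ → Eval N F ρ e₂ v₂ t₂ →
      Eval N F ρ (Expr.cons e₁ e₂) (Val.cons v₁ v₂) (t₁ + t₂ + 1)
  | caseList_nil {ρ : List (Val N)} {e e₁ e₂ : Expr} {v : Val N} {t t₁ : ℕ} :
      Eval N F ρ e Val.nil t → Eval N F ρ e₁ v t₁ →
      Eval N F ρ (Expr.caseList e e₁ e₂) v (t + t₁ + 1)
  | caseList_cons {ρ : List (Val N)} {e e₁ e₂ : Expr} {x y v : Val N} {t t₂ : ℕ} :
      Eval N F ρ e (Val.cons x y) t → Eval N F (x :: y :: ρ) e₂ v t₂ →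
      Eval N F ρ (Expr.caseList e e₁ e₂) v (t + t₂ + 1)
  | letIn {ρ : List (Val N)} {e₁ e₂ : Expr} {v₁ v₂ : Val N} {t₁ t₂ : ℕ} :
      Eval N F ρ e₁ v₁ t₁ → Eval N F (v₁ :: ρ) e₂ v₂ t₂ →
      Eval N F ρ (Expr.letIn e₁ e₂) v₂ (t₁ + t₂ + 1)
  | call {ρ : List (Val N)} {k : ℕ} {e body : Expr} {v w : Val N} {t t' : ℕ} :
      Eval N F ρ e v t → F[k]? = some body → Eval N F [v] body w t' →
      Eval N F ρ (Expr.call k e) w (t + t' + 1)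

/-- A program: a function table and a main expression. -/
structure Program where
  functions : List Expr
  main : Expr

/-- Modulo `N`, the program `P` started on the datum `x` halts with the result `y` after exactly
`t` steps. -/
def Program.Runs (P : Program) (N : ℕ) (x y : Val N) (t : ℕ) : Prop :=
  Eval N P.functions [x] P.main y t

/-! ### Input and result of an implementation -/

/-- A list of residues as a datum. -/
def encodeList {N : ℕ} : List (ZMod N) → Val N
  | [] => Val.nil
  | a :: l => Val.cons (Val.num a) (encodeList l)

/-- The printed output as a datum. -/
def encodeOutput (N : ℕ) : Output → Val N
  | Output.factor k => Val.num (k : ZMod N)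
  | Output.errorA => Val.nil
  | Output.errorB => Val.cons Val.nil Val.nil

/-- The input `(b_1, …, b_d), (s_1, …, s_d)`. -/
def inputVal (N : ℕ) {d : ℕ} (b s : Fin d → ℕ) : Val N :=
  Val.cons (encodeList (List.ofFn fun n => (b n : ZMod N)))
    (encodeList (List.ofFn fun n => (s n : ZMod N)))

/-- Everything the algorithm with the polynomials `X - b_n` has to compute: the `d + 1`
coefficients of `g` modulo `N` (Step 1), the values `y_1, …, y_d` (Step 2), and what is printed
in the end (Steps 3 to 6). -/
noncomputable def resultVal (N : ℕ) {d : ℕ} (b s : Fin d → ℕ) : Val N :=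
  Val.cons
    (encodeList (List.ofFn fun k : Fin (d + 1) => (gPoly N (linearPolys b)).coeff k))
    (Val.cons
      (encodeList (List.ofFn (yValue N (linearPolys b) s)))
      (encodeOutput N (output N (linearPolys b) s)))

/-- The program `P` carries out the algorithm with the polynomials `X - b_n`: for all `N, d ≥ 1`
and all `b_n` and `s_n` in `Z_N` it halts with the right results. -/
def Program.Implements (P : Program) : Prop :=
  ∀ (N d : ℕ) (b s : Fin d → ℕ), 0 < N → 0 < d → (∀ n, b n < N) → (∀ n, s n < N) →
    ∃ t : ℕ, P.Runs N (inputVal N b s) (resultVal N b s) t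

end DigitFactor

namespace DigitFactor

/-! ### Weakest preconditions for the cost model -/

/-! For part (b), `gcd(y_j, N)` equals the gcd of `∏ (s_j - b_i)` with `N`, so it is `1` exactly
when every `gcd(s_j - b_i, N)` is `1`. Since `b_i` and `s_j` are distinct members of `Z_N`, none of
these gcds is `N` (`IsSolution.gcd_ne`). For prime `N` they are all `1`, which gives 'Error A'. For
composite `N` the congruence modulo `p` provides a `j` with `G_j ≠ 1`. At the first such `j`, either
`G_j` is already proper, or Step 6 meets some `H_i ≠ 1`, and `H_i ≠ N`.

For part (a), everything rests on multiplying polynomials over `ZMod N` in `n^(1 + o(1))` operations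
without dividing by ring elements (`mul_spec`). The factors are cut into blocks of length `m`, which
makes them polynomials `F`, `G` in a new variable `Y` with coefficients in `R[X]`, and `Y = X^m`
restores the factors. `F * G` is computed at `Y = 1, X, X^2, …`, where evaluation only shifts and
adds, and Newton interpolation carries the values to `Y = X^m` (`ofList_extrapolateList`). Its only
divisions are exact ones by `X^j - 1`, which work over every commutative ring.

One level multiplies the cost per coefficient by at most `20` and adds `O(P^2)` for about `P`
blocks. With block sizes `2^((16 + i)^2)` consecutive sizes have ratio `2^(2 * i + 33)`, the depth
`r` is of order `√(log d)`, and the cost per coefficient is `O(32^r)`. As `2^((15 + r)^2) < d` for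
`r ≥ 1`, every fixed power `C^r` is `O(d^ε)` (`exists_pow_le_rpow`).

A product tree then yields `g`. The values `y_n` come from a tree that carries coefficients of the
expansion of `g / ∏ (X - s)` in powers of `1/X` instead of remainders: descending to a subset of the
points is a multiplication by the complementary factor (`quotList_of_append`), and at a single point
`s` the coefficient left is `g(s)` (`quotList_singleton`). The data at the root need one power
series inversion (`inverse_spec`, `reverse_tail_eq_quotList`). All of this costs logarithmically
many multiplications per level, and Steps 3 to 6 are linear in `d`. -/

/-- Function number `k` of the table `F`, called on `v`, returns `w` within `c` steps. -/
def Call {N : ℕ} (F : List Expr) (k : ℕ) (v w : Val N) (c : ℕ) : Prop :=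
  ∃ body t, F[k]? = some body ∧ Eval N F [v] body w t ∧ t ≤ c

/-- A call whose result and cost bound satisfy `Q`. -/
def WpCall {N : ℕ} (F : List Expr) (k : ℕ) (v : Val N) (Q : Val N → ℕ → Prop) : Prop :=
  ∃ w c, Call F k v w c ∧ Q w c

/-- The branching on a list datum. -/
def wpCase {N : ℕ} (v : Val N) (p : Prop) (q : Val N → Val N → Prop) : Prop :=
  match v with
  | Val.num _ => False
  | Val.nil => p
  | Val.cons x y => q x y

/-- A binary operation on residues. -/
def wpNum {N : ℕ} (v₁ v₂ : Val N) (q : ZMod N → ZMod N → Prop) : Prop :=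
  match v₁, v₂ with
  | Val.num a, Val.num b => q a b
  | _, _ => False

/-- The access to a variable. -/
def wpVar {N : ℕ} : List (Val N) → ℕ → (Val N → Prop) → Prop
  | [], _, _ => False
  | v :: _, 0, q => q v
  | _ :: ρ, i + 1, q => wpVar ρ i q

theorem wpVar_sound {N : ℕ} {ρ : List (Val N)} {i : ℕ} {q : Val N → Prop} (h : wpVar ρ i q) :
    ∃ v, ρ[i]? = some v ∧ q v := by
  induction ρ generalizing i with
  | nil => exact h.elim
  | cons v ρ ih =>
    cases i with
    | zero => exact ⟨v, rfl, h⟩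
    | succ i => exact ih h

/-- The expression `e` evaluates to a value that satisfies `Q` together with an upper bound for
the number of steps. -/
def wp {N : ℕ} (F : List Expr) : Expr → List (Val N) → (Val N → ℕ → Prop) → Prop
  | .var i, ρ, Q => wpVar ρ i fun v => Q v 1
  | .lit c, _, Q => Q (Val.num (c : ZMod N)) 1
  | .add e₁ e₂, ρ, Q => wp F e₁ ρ fun v₁ t₁ => wp F e₂ ρ fun v₂ t₂ =>
      wpNum v₁ v₂ fun a b => Q (Val.num (a + b)) (t₁ + t₂ + 1)
  | .sub e₁ e₂, ρ, Q => wp F e₁ ρ fun v₁ t₁ => wp F e₂ ρ fun v₂ t₂ =>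
      wpNum v₁ v₂ fun a b => Q (Val.num (a - b)) (t₁ + t₂ + 1)
  | .mul e₁ e₂, ρ, Q => wp F e₁ ρ fun v₁ t₁ => wp F e₂ ρ fun v₂ t₂ =>
      wpNum v₁ v₂ fun a b => Q (Val.num (a * b)) (t₁ + t₂ + 1)
  | .gcd e, ρ, Q => wp F e ρ fun v t =>
      wpNum v v fun a _ => Q (Val.num ((Nat.gcd a.val N : ℕ) : ZMod N)) (t + 1)
  | .ifEq e₁ e₂ e₃ e₄, ρ, Q => wp F e₁ ρ fun v₁ t₁ => wp F e₂ ρ fun v₂ t₂ =>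
      wpNum v₁ v₂ fun a b =>
        (a = b → wp F e₃ ρ fun v t => Q v (t₁ + t₂ + t + 1)) ∧
        (a ≠ b → wp F e₄ ρ fun v t => Q v (t₁ + t₂ + t + 1))
  | .nil, _, Q => Q Val.nil 1
  | .cons e₁ e₂, ρ, Q => wp F e₁ ρ fun v₁ t₁ => wp F e₂ ρ fun v₂ t₂ =>
      Q (Val.cons v₁ v₂) (t₁ + t₂ + 1)
  | .caseList e e₁ e₂, ρ, Q => wp F e ρ fun v t =>
      wpCase v (wp F e₁ ρ fun w t' => Q w (t + t' + 1))
        (fun x y => wp F e₂ (x :: y :: ρ) fun w t' => Q w (t + t' + 1))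
  | .letIn e₁ e₂, ρ, Q => wp F e₁ ρ fun v t => wp F e₂ (v :: ρ) fun w t' => Q w (t + t' + 1)
  | .call k e, ρ, Q => wp F e ρ fun v t => WpCall F k v fun w t' => Q w (t + t' + 1)

/-- This turns verification into symbolic execution: unfolding `wp` on a concrete body leaves one
`WpCall` goal per function call, in evaluation order, and a final goal with the value and the summed
cost. Costs are upper bounds, since the exact step count of a callee is not tracked. -/
theorem wp_sound {N : ℕ} {F : List Expr} (e : Expr) :
    ∀ {ρ : List (Val N)} {Q : Val N → ℕ → Prop}, wp F e ρ Q →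
      ∃ v t c, Eval N F ρ e v t ∧ t ≤ c ∧ Q v c := by
  induction e with
  | var i =>
    intro ρ Q h
    obtain ⟨v, hv, hQ⟩ := wpVar_sound h
    exact ⟨v, 1, 1, .var hv, le_rfl, hQ⟩
  | lit c => intro ρ Q h; exact ⟨_, 1, 1, .lit, le_rfl, h⟩
  | nil => intro ρ Q h; exact ⟨_, 1, 1, .nil, le_rfl, h⟩
  | add e₁ e₂ h₁ h₂ =>
    intro ρ Q h
    obtain ⟨v₁, t₁, c₁, E₁, l₁, h⟩ := h₁ h
    obtain ⟨v₂, t₂, c₂, E₂, l₂, h⟩ := h₂ h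
    rcases v₁ with a | _ | _ <;> rcases v₂ with b | _ | _ <;> try exact h.elim
    exact ⟨_, _, _, .add E₁ E₂, by omega, h⟩
  | sub e₁ e₂ h₁ h₂ =>
    intro ρ Q h
    obtain ⟨v₁, t₁, c₁, E₁, l₁, h⟩ := h₁ h
    obtain ⟨v₂, t₂, c₂, E₂, l₂, h⟩ := h₂ h
    rcases v₁ with a | _ | _ <;> rcases v₂ with b | _ | _ <;> try exact h.elim
    exact ⟨_, _, _, .sub E₁ E₂, by omega, h⟩
  | mul e₁ e₂ h₁ h₂ =>
    intro ρ Q h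
    obtain ⟨v₁, t₁, c₁, E₁, l₁, h⟩ := h₁ h
    obtain ⟨v₂, t₂, c₂, E₂, l₂, h⟩ := h₂ h
    rcases v₁ with a | _ | _ <;> rcases v₂ with b | _ | _ <;> try exact h.elim
    exact ⟨_, _, _, .mul E₁ E₂, by omega, h⟩
  | gcd e h₁ =>
    intro ρ Q h
    obtain ⟨v₁, t₁, c₁, E₁, l₁, h⟩ := h₁ h
    rcases v₁ with a | _ | _ <;> try exact h.elim
    exact ⟨_, _, _, .gcd E₁, by omega, h⟩
  | ifEq e₁ e₂ e₃ e₄ h₁ h₂ h₃ h₄ =>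
    intro ρ Q h
    obtain ⟨v₁, t₁, c₁, E₁, l₁, h⟩ := h₁ h
    obtain ⟨v₂, t₂, c₂, E₂, l₂, h⟩ := h₂ h
    rcases v₁ with a | _ | _ <;> rcases v₂ with b | _ | _ <;> try exact h.elim
    by_cases hab : a = b
    · obtain ⟨v, t, c, E, l, h⟩ := h₃ (h.1 hab)
      exact ⟨_, _, _, .ifEq_true E₁ E₂ hab E, by omega, h⟩
    · obtain ⟨v, t, c, E, l, h⟩ := h₄ (h.2 hab)
      exact ⟨_, _, _, .ifEq_false E₁ E₂ hab E, by omega, h⟩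
  | cons e₁ e₂ h₁ h₂ =>
    intro ρ Q h
    obtain ⟨v₁, t₁, c₁, E₁, l₁, h⟩ := h₁ h
    obtain ⟨v₂, t₂, c₂, E₂, l₂, h⟩ := h₂ h
    exact ⟨_, _, _, .cons E₁ E₂, by omega, h⟩
  | caseList e e₁ e₂ h₀ h₁ h₂ =>
    intro ρ Q h
    obtain ⟨v, t, c, E, l, h⟩ := h₀ h
    rcases v with _ | _ | ⟨x, y⟩
    · exact h.elim
    · obtain ⟨v', t', c', E', l', h⟩ := h₁ h
      exact ⟨_, _, _, .caseList_nil E E', by omega, h⟩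
    · obtain ⟨v', t', c', E', l', h⟩ := h₂ h
      exact ⟨_, _, _, .caseList_cons E E', by omega, h⟩
  | letIn e₁ e₂ h₁ h₂ =>
    intro ρ Q h
    obtain ⟨v₁, t₁, c₁, E₁, l₁, h⟩ := h₁ h
    obtain ⟨v₂, t₂, c₂, E₂, l₂, h⟩ := h₂ h
    exact ⟨_, _, _, .letIn E₁ E₂, by omega, h⟩
  | call k e h₁ =>
    intro ρ Q h
    obtain ⟨v, t, c, E, l, w, c', ⟨body, t', hF, E', l'⟩, h⟩ := h₁ h
    exact ⟨_, _, _, .call E hF E', by omega, h⟩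

theorem Call.of_wp {N : ℕ} {F : List Expr} {k : ℕ} {body : Expr} {v w : Val N} {c : ℕ}
    (hF : F[k]? = some body) (h : wp F body [v] fun w' c' => w' = w ∧ c' ≤ c) :
    Call F k v w c := by
  obtain ⟨w', t, c', E, l, rfl, h'⟩ := wp_sound body h
  exact ⟨body, t, hF, E, l.trans h'⟩

theorem Call.mono {N : ℕ} {F : List Expr} {k : ℕ} {v w : Val N} {c c' : ℕ}
    (h : Call F k v w c) (hc : c ≤ c') : Call F k v w c' := by
  obtain ⟨body, t, hF, E, l⟩ := h
  exact ⟨body, t, hF, E, l.trans hc⟩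

theorem WpCall.intro {N : ℕ} {F : List Expr} {k : ℕ} {v w : Val N} {c : ℕ}
    {Q : Val N → ℕ → Prop} (h : Call F k v w c) (hQ : Q w c) : WpCall F k v Q :=
  ⟨w, c, h, hQ⟩

/-! ### The program -/

namespace Prog

/-- `c • f + g` for coefficient lists. -/
def axpy : Expr :=
  .caseList (.var 0) .nil <| .caseList (.var 1) .nil <|
    .caseList (.var 0) (.var 1) <| .caseList (.var 3)
      (.cons (.mul (.var 4) (.var 0)) (.call 0 (.cons (.var 4) (.cons (.var 1) .nil))))
      (.cons (.add (.mul (.var 6) (.var 2)) (.var 0))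
        (.call 0 (.cons (.var 6) (.cons (.var 3) (.var 1)))))

/-- The schoolbook product of coefficient lists. -/
def schoolMul : Expr :=
  .caseList (.var 0) .nil <| .caseList (.var 0) .nil <|
    .call 0 (.cons (.var 0) (.cons (.var 3) (.cons (.lit 0) (.call 1 (.cons (.var 1) (.var 3))))))

/-- Put as many zeros in front of a list as the counter tells. -/
def shift : Expr :=
  .caseList (.var 0) .nil <| .caseList (.var 0) (.var 1) <|
    .cons (.lit 0) (.call 2 (.cons (.var 1) (.var 3)))

/-- Truncate a list to the length of the counter, or pad it with zeros. -/
def fit : Expr :=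
  .caseList (.var 0) .nil <| .caseList (.var 0) .nil <| .caseList (.var 3)
    (.cons (.lit 0) (.call 3 (.cons (.var 1) .nil)))
    (.cons (.var 0) (.call 3 (.cons (.var 3) (.var 1))))

/-- Numbers are represented in unary by lists. The first argument here and in `take` is such a
counter: only its length is used. -/
def drop : Expr :=
  .caseList (.var 0) .nil <| .caseList (.var 0) (.var 1) <| .caseList (.var 3) .nil
    (.call 4 (.cons (.var 3) (.var 1)))

def take : Expr :=
  .caseList (.var 0) .nil <| .caseList (.var 0) .nil <| .caseList (.var 3) .nil
    (.cons (.var 0) (.call 5 (.cons (.var 3) (.var 1))))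

def append : Expr :=
  .caseList (.var 0) .nil <| .caseList (.var 0) (.var 1) <|
    .cons (.var 0) (.call 6 (.cons (.var 1) (.var 3)))

/-- Cut a list into blocks. -/
def chunks : Expr :=
  .caseList (.var 0) .nil <| .caseList (.var 1) .nil <|
    .cons (.call 5 (.cons (.var 2) (.var 3)))
      (.call 7 (.cons (.var 2) (.call 4 (.cons (.var 2) (.var 3)))))

/-- Evaluate a polynomial with polynomial coefficients at `X ^ j`. -/
def evalAt : Expr :=
  .caseList (.var 0) .nil <| .caseList (.var 1) .nil <|
    .call 0 (.cons (.lit 1) (.cons (.var 0)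
      (.call 2 (.cons (.var 2) (.call 8 (.cons (.var 2) (.var 1)))))))

/-- The products of the values of two polynomials at `X ^ j`, `X ^ (j + 1)`, … -/
def pointProducts : Expr :=
  .caseList (.var 0) .nil <| .caseList (.var 1) .nil <| .caseList (.var 1) .nil <|
    .caseList (.var 1) .nil <| .caseList (.var 2) .nil <|
      .cons
        (.call 10 (.cons (.var 8) (.cons (.call 8 (.cons (.var 6) (.var 2)))
          (.call 8 (.cons (.var 6) (.var 3))))))
        (.call 9 (.cons (.var 8) (.cons (.cons .nil (.var 6)) (.cons (.var 1) (.var 5)))))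

/-- The product of coefficient lists, by evaluation at powers of `X` and extrapolation. -/
def mul : Expr :=
  .caseList (.var 0) .nil <| .caseList (.var 1) .nil <|
    -- Without block sizes the schoolbook product is taken; `f ++ g` serves as the counter for the
    -- length of the result.
    .caseList (.var 2) (.call 3 (.cons (.call 6 (.var 3)) (.call 1 (.var 3)))) <|
    -- If `f ++ g` has at most `m` members, the block size `m` is too large and is skipped.
    .caseList (.call 4 (.cons (.var 0) (.call 6 (.var 5))))
      (.call 10 (.cons (.var 1) (.var 5))) <|
      .letIn (.call 7 (.cons (.var 2) (.var 4))) <|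
      .letIn (.call 7 (.cons (.var 3) (.var 6))) <|
        .call 3 (.cons (.call 6 (.var 9)) (.call 13 (.cons (.var 4)
          (.call 9 (.cons (.var 5) (.cons .nil
            -- The number of evaluation points is the total number of blocks, counted by the
            -- concatenated lists of blocks.
            (.cons (.call 6 (.cons (.var 1) (.var 0))) (.cons (.var 1) (.var 0)))))))))

/-- Division by `X ^ j - 1`, with the last `j` coefficients of the quotient as a queue. -/
def divQueue : Expr :=
  .caseList (.var 0) .nil <| .caseList (.var 1) .nil <| .caseList (.var 2) .nil <|
    .letIn (.sub (.var 0) (.var 2)) <|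
      .cons (.var 0) (.call 11 (.cons (.call 6 (.cons (.var 2) (.cons (.var 0) .nil))) (.var 4)))

/-- The quotients of `w - v` by `X ^ j - 1`, `X ^ (j + 1) - 1`, … for the members `w` of a list. -/
def dividedDiffs : Expr :=
  .caseList (.var 0) .nil <| .caseList (.var 1) .nil <| .caseList (.var 1) .nil <|
    .cons
      (.call 11 (.cons (.call 2 (.cons (.var 4) .nil))
        (.call 0 (.cons (.sub (.lit 0) (.lit 1)) (.cons (.var 2) (.var 0))))))
      (.call 12 (.cons (.cons .nil (.var 4)) (.cons (.var 2) (.var 1))))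

/-- From the values of a polynomial at `1`, `X`, `X ^ 2`, … its value at `X ^ m`. -/
def extrapolate : Expr :=
  .caseList (.var 0) .nil <| .caseList (.var 1) .nil <|
    .letIn (.call 13 (.cons (.caseList (.var 2) .nil (.var 1))
      (.call 12 (.cons (.cons .nil .nil) (.cons (.var 0) (.var 1)))))) <|
      .call 0 (.cons (.lit 1) (.cons (.var 1)
        (.call 0 (.cons (.sub (.lit 0) (.lit 1)) (.cons (.var 0)
          (.call 2 (.cons (.var 3) (.var 0))))))))

/-- The product of counters. -/
def mulCount : Expr :=
  .caseList (.var 0) .nil <| .caseList (.var 0) .nil <|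
    .call 6 (.cons (.var 3) (.call 14 (.cons (.var 1) (.var 3))))

/-- The list of the block sizes. -/
def grow : Expr :=
  .caseList (.var 0) .nil <| .caseList (.var 1) .nil <| .caseList (.var 1) .nil <|
    .caseList (.call 4 (.cons (.var 0) (.var 4))) (.var 1) <|
      .letIn (.call 6 (.cons (.var 4) (.var 4))) <|
        .call 15 (.cons (.var 7) (.cons (.call 6 (.cons (.var 0) (.var 0)))
          (.cons (.call 14 (.cons (.var 5) (.var 3))) (.cons (.var 3) (.var 4)))))

/-- Every other member of a list. -/
def evens : Expr :=
  .caseList (.var 0) .nil <|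
    .cons (.var 0) (.caseList (.var 1) .nil (.call 16 (.var 1)))

/-- The monic polynomial with the given roots. -/
def rootsPoly : Expr :=
  .caseList (.var 0) .nil <| .caseList (.var 1) (.cons (.lit 1) .nil) <|
    .caseList (.var 1) (.cons (.sub (.lit 0) (.var 0)) (.cons (.lit 1) .nil)) <|
      .letIn (.call 16 (.var 5)) <| .letIn (.call 5 (.cons (.var 0) (.var 6))) <|
      .letIn (.call 4 (.cons (.var 1) (.var 7))) <|
        .call 3 (.cons (.cons .nil (.var 8)) (.call 10 (.cons (.var 7)
          (.cons (.call 17 (.cons (.var 7) (.var 1))) (.call 17 (.cons (.var 7) (.var 0)))))))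

/-- The inverse of a power series with constant term `1`. -/
def inverse : Expr :=
  .caseList (.var 0) .nil <| .caseList (.var 1) .nil <|
    .caseList (.var 1) (.cons (.lit 1) .nil) <| .caseList (.var 1) (.cons (.lit 1) .nil) <|
      .letIn (.call 18 (.cons (.var 6) (.cons (.var 4) (.call 16 (.var 5))))) <|
        .call 3 (.cons (.var 5) (.call 10 (.cons (.var 7) (.cons (.var 0)
          (.call 0 (.cons (.sub (.lit 0) (.lit 1)) (.cons
            (.call 10 (.cons (.var 7) (.cons (.var 5) (.var 0))))
            (.cons (.lit 2) .nil))))))))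

def reverse : Expr :=
  .caseList (.var 0) .nil <| .caseList (.var 0) (.var 1) <|
    .call 19 (.cons (.var 1) (.cons (.var 0) (.var 3)))

/-- The values at the points of a list, from the leading coefficients of the quotient by the
polynomial with these roots. -/
def evalTree : Expr :=
  .caseList (.var 0) .nil <| .caseList (.var 1) .nil <| .caseList (.var 0) .nil <|
    .caseList (.var 1) (.var 3) <|
      .letIn (.call 16 (.var 4)) <| .letIn (.call 5 (.cons (.var 0) (.var 5))) <|
      .letIn (.call 4 (.cons (.var 1) (.var 6))) <|
        .call 6 (.cons
          (.call 21 (.cons (.var 9) (.cons (.var 1) (.cons (.var 0) (.var 8)))))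
          (.call 21 (.cons (.var 9) (.cons (.var 0) (.cons (.var 1) (.var 8))))))

/-- One branch of `evalTree`. -/
def evalBranch : Expr :=
  .caseList (.var 0) .nil <| .caseList (.var 1) .nil <| .caseList (.var 1) .nil <|
    .call 20 (.cons (.var 4) (.cons (.var 2) (.call 3 (.cons (.var 2)
      (.call 4 (.cons (.var 0) (.call 10 (.cons (.var 4)
        (.cons (.call 17 (.cons (.var 4) (.var 0))) (.var 1))))))))))

/-- The values of a polynomial at the points of a list. -/
def values : Expr :=
  .caseList (.var 0) .nil <| .caseList (.var 1) .nil <|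
    .letIn (.call 19 (.cons (.call 17 (.cons (.var 2) (.var 1))) .nil)) <|
    .letIn (.call 18 (.cons (.var 3) (.cons (.var 0) (.var 0)))) <|
    .letIn (.call 3 (.cons (.var 1) (.call 10 (.cons (.var 4)
      (.cons (.call 19 (.cons (.var 2) .nil)) (.var 0)))))) <|
      .call 20 (.cons (.var 5) (.cons (.var 4)
        (.call 19 (.cons (.caseList (.var 0) .nil (.var 1)) .nil))))

/-- Steps 5 and 6. -/
def searchBase : Expr :=
  .caseList (.var 0) .nil <| .caseList (.var 1) (.cons .nil .nil) <|
    .letIn (.gcd (.sub (.var 2) (.var 0))) <|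
      .ifEq (.var 0) (.lit 1) (.call 23 (.cons (.var 3) (.var 2))) <|
        -- A gcd is returned modulo `N`, so the value `N` appears as the residue `0`.
        .ifEq (.var 0) (.lit 0) (.call 23 (.cons (.var 3) (.var 2))) (.var 0)

/-- Steps 3 and 4. -/
def searchPoint : Expr :=
  .caseList (.var 0) .nil <| .caseList (.var 1) .nil <| .caseList (.var 2) .nil <|
    .caseList (.var 2) .nil <|
      .letIn (.gcd (.var 2)) <|
        .ifEq (.var 0) (.lit 1) (.call 24 (.cons (.var 4) (.cons (.var 2) (.var 6)))) <|
          .ifEq (.var 0) (.lit 0) (.call 23 (.cons (.var 1) (.var 6))) (.var 0)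

/-- The parameters with which `grow` starts. -/
def start : Expr :=
  .letIn (.cons .nil (.cons .nil .nil)) <|
  .letIn (.call 14 (.cons (.var 0) (.var 0))) <|
  .letIn (.call 14 (.cons (.var 0) (.var 0))) <|
  .letIn (.call 14 (.cons (.var 0) (.var 0))) <|
  .letIn (.call 14 (.cons (.var 0) (.var 0))) <|
  .letIn (.call 14 (.cons (.var 0) (.var 0))) <|
  .letIn (.call 14 (.cons (.var 0) (.var 0))) <|
  .letIn (.call 14 (.cons (.var 0) (.var 0))) <|
  .letIn (.call 14 (.cons (.var 0) (.var 0))) <|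
    -- Eight squarings of `2` give `2^256`, the smallest block size; variable `3` is `2^32`, whose
    -- double `2^33` is the first ratio.
    .cons (.call 6 (.cons (.var 3) (.var 3))) (.var 0)

/-- The function table. -/
def table : List Expr :=
  [axpy, schoolMul, shift, fit, drop, take, append, chunks, evalAt, pointProducts, mul, divQueue,
    dividedDiffs, extrapolate, mulCount, grow, evens, rootsPoly, inverse, reverse, evalTree,
    evalBranch, values, searchBase, searchPoint, start]

/-- The main expression. -/
def main : Expr :=
  .caseList (.var 0) .nil <|
    .letIn (.caseList (.call 25 .nil) .nil
      (.call 15 (.cons (.var 2) (.cons (.var 0) (.cons (.var 1) .nil))))) <|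
    .letIn (.call 17 (.cons (.var 0) (.var 1))) <|
    .letIn (.call 22 (.cons (.var 1) (.cons (.var 0) (.var 3)))) <|
      .cons (.var 1) (.cons (.var 0) (.call 24 (.cons (.var 0) (.cons (.var 4) (.var 3)))))

end Prog

/-- The program that carries out the algorithm. -/
def factorProgram : Program := ⟨Prog.table, Prog.main⟩

/-! ### Specifications of the list functions -/

/-- A list of data as a datum. -/
def listVal {N : ℕ} : List (Val N) → Val N
  | [] => Val.nil
  | x :: l => Val.cons x (listVal l)

/-- A coefficient list as a datum. -/
def polyVal {N : ℕ} (l : List (ZMod N)) : Val N := listVal (l.map Val.num)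

theorem encodeList_eq_polyVal {N : ℕ} (l : List (ZMod N)) : encodeList l = polyVal l := by
  induction l with
  | nil => rfl
  | cons a l ih => simp [encodeList, polyVal, listVal, ih]

/-- `c • f + g` for coefficient lists. -/
def axpyList {R : Type*} [CommRing R] (c : R) : List R → List R → List R
  | [], g => g
  | a :: f, [] => c * a :: axpyList c f []
  | a :: f, b :: g => (c * a + b) :: axpyList c f g

/-- The schoolbook product. -/
def schoolMulList {R : Type*} [CommRing R] : List R → List R → List R
  | [], _ => []
  | a :: f, g => axpyList a g (0 :: schoolMulList f g)

/-- The first `n` members of a list, padded with zeros. -/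
def fitList {R : Type*} [CommRing R] : ℕ → List R → List R
  | 0, _ => []
  | n + 1, [] => 0 :: fitList n []
  | n + 1, a :: l => a :: fitList n l

/-- Every other member of a list. -/
def evensList {α : Type*} : List α → List α
  | [] => []
  | [a] => [a]
  | a :: _ :: l => a :: evensList l

/-- Cut a list into blocks of length `m`. -/
def chunksList {α : Type*} (m : ℕ) : List α → List (List α)
  | [] => []
  -- The head is split off so that the recursion terminates for `m = 0` as well.
  | a :: l => (a :: l.take (m - 1)) :: chunksList m (l.drop (m - 1))
termination_by l => l.length
decreasing_by simp only [List.length_drop, List.length_cons]; omega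

/-- Evaluate a list of coefficient lists at `X ^ j`. -/
def evalAtList {R : Type*} [CommRing R] (j : ℕ) : List (List R) → List R
  | [] => []
  | f :: F => axpyList 1 f (List.replicate j 0 ++ evalAtList j F)

/-- Division of a coefficient list by `X ^ j - 1`. -/
def divQueueList {R : Type*} [CommRing R] : List R → List R → List R
  | _, [] => []
  | [], _ => []
  | c :: q, a :: u => (c - a) :: divQueueList (q ++ [c - a]) u

/-- Division of `w - v` by `X ^ j - 1`, `X ^ (j + 1) - 1`, … -/
def dividedDiffsList {R : Type*} [CommRing R] (v : List R) : ℕ → List (List R) → List (List R)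
  | _, [] => []
  | j, w :: ws => divQueueList (List.replicate j 0) (axpyList (-1) v w) ::
      dividedDiffsList v (j + 1) ws

theorem length_dividedDiffsList {R : Type*} [CommRing R] (v : List R) (j : ℕ)
    (ws : List (List R)) : (dividedDiffsList v j ws).length = ws.length := by
  induction ws generalizing j with
  | nil => rfl
  | cons w ws ih => simp [dividedDiffsList, ih]

/-- Extrapolation to `X ^ m`. -/
def extrapolateList {R : Type*} [CommRing R] (m : ℕ) : List (List R) → List R
  | [] => []
  -- This is `H(X^m) = H(1) + (X^m - 1) * K(X^m)` for `K = (H - H(1)) / (Y - 1)`. The recursive call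
  -- has `m - 1` because it interpolates `K(X * Y)`, whose value at `X^(m - 1)` is `K(X^m)`.
  | v :: vs => axpyList 1 v
      (axpyList (-1) (extrapolateList (m - 1) (dividedDiffsList v 1 vs))
        (List.replicate m 0 ++ extrapolateList (m - 1) (dividedDiffsList v 1 vs)))
termination_by l => l.length
decreasing_by all_goals simp [length_dividedDiffsList]

theorem length_axpyList {R : Type*} [CommRing R] (c : R) (f g : List R) :
    (axpyList c f g).length = max f.length g.length := by
  induction f generalizing g with
  | nil => simp [axpyList]
  | cons a f ih => cases g <;> simp [axpyList, ih]

theorem length_evensList {α : Type*} (l : List α) :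
    (evensList l).length = (l.length + 1) / 2 := by
  induction l using evensList.induct with
  | case1 => simp [evensList]
  | case2 => simp [evensList]
  | case3 a b l ih => simp only [evensList, List.length_cons, ih]; omega

section Specs

variable {N : ℕ}

theorem listVal_nil : listVal ([] : List (Val N)) = .nil := rfl

theorem listVal_cons (x : Val N) (l : List (Val N)) :
    listVal (x :: l) = .cons x (listVal l) := rfl

theorem polyVal_nil : polyVal ([] : List (ZMod N)) = .nil := rfl

theorem polyVal_cons (a : ZMod N) (l : List (ZMod N)) :
    polyVal (a :: l) = .cons (.num a) (polyVal l) := rfl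

/-- A list of coefficient lists as a datum. -/
def polysVal (F : List (List (ZMod N))) : Val N := listVal (F.map polyVal)

theorem polysVal_nil : polysVal ([] : List (List (ZMod N))) = .nil := rfl

theorem polysVal_cons (f : List (ZMod N)) (F : List (List (ZMod N))) :
    polysVal (f :: F) = .cons (polyVal f) (polysVal F) := rfl

/-- A counter as a datum. -/
def countVal (N n : ℕ) : Val N := listVal (List.replicate n .nil)

theorem countVal_zero : countVal N 0 = .nil := rfl

theorem countVal_succ (n : ℕ) : countVal N (n + 1) = .cons .nil (countVal N n) := rfl

theorem axpy_spec (c : ZMod N) (f g : List (ZMod N)) :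
    Call Prog.table 0 (.cons (.num c) (.cons (polyVal f) (polyVal g)))
      (polyVal (axpyList c f g)) (30 * (f.length + 1)) := by
  induction f generalizing g with
  | nil =>
    refine Call.of_wp (body := Prog.axpy) rfl ?_
    simp only [wp, wpVar, wpCase, Prog.axpy, polyVal_nil, axpyList]
    simp
  | cons a f ih =>
    refine Call.of_wp (body := Prog.axpy) rfl ?_
    cases g with
    | nil =>
      simp only [wp, wpVar, wpCase, wpNum, Prog.axpy, polyVal_cons, polyVal_nil, axpyList]
      refine WpCall.intro (ih []) ⟨rfl, ?_⟩
      simp only [List.length_cons]; omega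
    | cons b g =>
      simp only [wp, wpVar, wpCase, wpNum, Prog.axpy, polyVal_cons, axpyList]
      refine WpCall.intro (ih g) ⟨rfl, ?_⟩
      simp only [List.length_cons]; omega

theorem schoolMul_spec (f g : List (ZMod N)) :
    Call Prog.table 1 (.cons (polyVal f) (polyVal g))
      (polyVal (schoolMulList f g)) (60 * ((f.length + 1) * (g.length + 1))) := by
  induction f with
  | nil =>
    refine Call.of_wp (body := Prog.schoolMul) rfl ?_
    simp only [wp, wpVar, wpCase, Prog.schoolMul, polyVal_nil, schoolMulList]
    simp only [List.length_nil, true_and]; omega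
  | cons a f ih =>
    refine Call.of_wp (body := Prog.schoolMul) rfl ?_
    simp only [wp, wpVar, wpCase, Prog.schoolMul, polyVal_cons, schoolMulList, Nat.cast_zero]
    refine WpCall.intro ih ?_
    refine WpCall.intro (axpy_spec a g (0 :: schoolMulList f g)) ⟨rfl, ?_⟩
    simp only [List.length_cons]; nlinarith

theorem shift_spec (c : List (Val N)) (f : List (ZMod N)) :
    Call Prog.table 2 (.cons (listVal c) (polyVal f))
      (polyVal (List.replicate c.length 0 ++ f)) (20 * (c.length + 1)) := by
  induction c with
  | nil =>
    refine Call.of_wp (body := Prog.shift) rfl ?_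
    simp only [wp, wpVar, wpCase, Prog.shift, listVal_nil]
    simp
  | cons a c ih =>
    refine Call.of_wp (body := Prog.shift) rfl ?_
    simp only [wp, wpVar, wpCase, Prog.shift, listVal_cons, Nat.cast_zero]
    refine WpCall.intro ih ⟨rfl, ?_⟩
    simp only [List.length_cons]; omega

theorem fit_spec (c : List (Val N)) (f : List (ZMod N)) :
    Call Prog.table 3 (.cons (listVal c) (polyVal f))
      (polyVal (fitList c.length f)) (20 * (c.length + 1)) := by
  induction c generalizing f with
  | nil =>
    refine Call.of_wp (body := Prog.fit) rfl ?_
    simp only [wp, wpVar, wpCase, Prog.fit, listVal_nil]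
    simp [fitList, polyVal_nil]
  | cons a c ih =>
    refine Call.of_wp (body := Prog.fit) rfl ?_
    cases f with
    | nil =>
      simp only [wp, wpVar, wpCase, Prog.fit, listVal_cons, polyVal_nil, List.length_cons, fitList,
        Nat.cast_zero]
      refine WpCall.intro (ih []) ⟨rfl, ?_⟩
      omega
    | cons b f =>
      simp only [wp, wpVar, wpCase, Prog.fit, listVal_cons, polyVal_cons, List.length_cons, fitList]
      refine WpCall.intro (ih f) ⟨rfl, ?_⟩
      omega

/-- The minimum in the cost matters: block sizes serve as counters and may be far longer than the
list that is tested against them. -/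
theorem drop_spec (c l : List (Val N)) :
    Call Prog.table 4 (.cons (listVal c) (listVal l))
      (listVal (l.drop c.length)) (20 * (min c.length l.length + 1)) := by
  induction c generalizing l with
  | nil =>
    refine Call.of_wp (body := Prog.drop) rfl ?_
    simp only [wp, wpVar, wpCase, Prog.drop, listVal_nil]
    simp
  | cons a c ih =>
    refine Call.of_wp (body := Prog.drop) rfl ?_
    cases l with
    | nil =>
      simp only [wp, wpVar, wpCase, Prog.drop, listVal_cons, listVal_nil]
      simp [listVal_nil]
    | cons b l =>
      simp only [wp, wpVar, wpCase, Prog.drop, listVal_cons, List.length_cons, List.drop_succ_cons]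
      refine WpCall.intro (ih l) ⟨rfl, ?_⟩
      omega

theorem take_spec (c l : List (Val N)) :
    Call Prog.table 5 (.cons (listVal c) (listVal l))
      (listVal (l.take c.length)) (20 * (min c.length l.length + 1)) := by
  induction c generalizing l with
  | nil =>
    refine Call.of_wp (body := Prog.take) rfl ?_
    simp only [wp, wpVar, wpCase, Prog.take, listVal_nil]
    simp [listVal_nil]
  | cons a c ih =>
    refine Call.of_wp (body := Prog.take) rfl ?_
    cases l with
    | nil =>
      simp only [wp, wpVar, wpCase, Prog.take, listVal_cons, listVal_nil]
      simp [listVal_nil]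
    | cons b l =>
      simp only [wp, wpVar, wpCase, Prog.take, listVal_cons, List.length_cons, List.take_succ_cons]
      refine WpCall.intro (ih l) ⟨rfl, ?_⟩
      omega

theorem append_spec (l l' : List (Val N)) :
    Call Prog.table 6 (.cons (listVal l) (listVal l'))
      (listVal (l ++ l')) (20 * (l.length + 1)) := by
  induction l with
  | nil =>
    refine Call.of_wp (body := Prog.append) rfl ?_
    simp only [wp, wpVar, wpCase, Prog.append, listVal_nil]
    simp
  | cons a c ih =>
    refine Call.of_wp (body := Prog.append) rfl ?_
    simp only [wp, wpVar, wpCase, Prog.append, listVal_cons, List.cons_append]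
    refine WpCall.intro ih ⟨rfl, ?_⟩
    simp only [List.length_cons]; omega

theorem drop_polyVal_spec (c : List (Val N)) (f : List (ZMod N)) :
    Call Prog.table 4 (.cons (listVal c) (polyVal f))
      (polyVal (f.drop c.length)) (20 * (min c.length f.length + 1)) := by
  simpa [polyVal, List.map_drop] using drop_spec c (f.map Val.num)

theorem take_polyVal_spec (c : List (Val N)) (f : List (ZMod N)) :
    Call Prog.table 5 (.cons (listVal c) (polyVal f))
      (polyVal (f.take c.length)) (20 * (min c.length f.length + 1)) := by
  simpa [polyVal, List.map_take] using take_spec c (f.map Val.num)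

theorem append_polyVal_spec (f g : List (ZMod N)) :
    Call Prog.table 6 (.cons (polyVal f) (polyVal g))
      (polyVal (f ++ g)) (20 * (f.length + 1)) := by
  simpa [polyVal] using append_spec (f.map Val.num) (g.map Val.num)

theorem chunksList_cons {α : Type*} {m : ℕ} (hm : 0 < m) (a : α) (l : List α) :
    chunksList m (a :: l) = (a :: l).take m :: chunksList m ((a :: l).drop m) := by
  obtain ⟨m, rfl⟩ := Nat.exists_eq_succ_of_ne_zero hm.ne'
  rw [chunksList]
  simp

theorem chunks_spec {m : ℕ} (hm : 0 < m) (f : List (ZMod N)) :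
    Call Prog.table 7 (.cons (countVal N m) (polyVal f))
      (polysVal (chunksList m f)) (100 * (f.length + 1)) := by
  induction hn : f.length using Nat.strong_induction_on generalizing f with
  | _ n ih =>
    subst hn
    refine Call.of_wp (body := Prog.chunks) rfl ?_
    cases f with
    | nil =>
      simp only [wp, wpVar, wpCase, Prog.chunks, polyVal_nil, chunksList]
      simp [polysVal_nil]
    | cons a f =>
      simp only [wp, wpVar, wpCase, Prog.chunks, polyVal_cons, countVal]
      have h₁ := take_polyVal_spec (List.replicate m .nil) (a :: f)
      have h₂ := drop_polyVal_spec (List.replicate m .nil) (a :: f)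
      have h₃ := ih _ (by simp only [List.length_drop, List.length_cons]; omega)
        ((a :: f).drop m) rfl
      rw [List.length_replicate] at h₁ h₂
      refine WpCall.intro h₁ (WpCall.intro h₂ (WpCall.intro h₃ ⟨?_, ?_⟩))
      · rw [chunksList_cons hm, polysVal_cons]
      · simp only [List.length_drop, List.length_cons]; omega

theorem length_mul_chunksList_le {α : Type*} {m : ℕ} (hm : 0 < m) (l : List α) :
    (chunksList m l).length * m ≤ l.length + m := by
  induction hn : l.length using Nat.strong_induction_on generalizing l with
  | _ n ih =>
    subst hn
    cases l with
    | nil => simp [chunksList]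
    | cons a l =>
      have := ih _ (by simp only [List.length_drop, List.length_cons]; omega)
        ((a :: l).drop m) rfl
      rw [chunksList_cons hm, List.length_cons, add_mul]
      rcases le_total m (a :: l).length with h | h
      · rw [List.length_drop] at this; omega
      · rw [List.drop_eq_nil_of_le h]; simp [chunksList]

theorem length_le_of_mem_chunksList {α : Type*} {m : ℕ} (hm : 0 < m) {l f : List α}
    (hf : f ∈ chunksList m l) : f.length ≤ m := by
  induction hn : l.length using Nat.strong_induction_on generalizing l with
  | _ n ih =>
    subst hn
    cases l with
    | nil => simp [chunksList] at hf
    | cons a l =>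
      rw [chunksList_cons hm, List.mem_cons] at hf
      rcases hf with rfl | hf
      · exact List.length_take_le _ _
      · exact ih _ (by simp only [List.length_drop, List.length_cons]; omega) hf rfl

theorem length_evalAtList_le {R : Type*} [CommRing R] {m : ℕ} (j : ℕ) {F : List (List R)}
    (hF : ∀ f ∈ F, f.length ≤ m) : (evalAtList j F).length ≤ m + j * F.length := by
  induction F with
  | nil => simp [evalAtList]
  | cons f F ih =>
    have h₁ := hF f (by simp)
    have h₂ := ih fun g hg => hF g (by simp [hg])
    simp only [evalAtList, length_axpyList, List.length_append, List.length_replicate,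
      List.length_cons, mul_add]
    omega

theorem evalAt_spec {m : ℕ} (j : ℕ) {F : List (List (ZMod N))} (hF : ∀ f ∈ F, f.length ≤ m) :
    Call Prog.table 8 (.cons (countVal N j) (polysVal F)) (polyVal (evalAtList j F))
      ((F.length + 1) * (30 * m + 20 * j + 100)) := by
  induction F with
  | nil =>
    refine Call.of_wp (body := Prog.evalAt) rfl ?_
    simp only [wp, wpVar, wpCase, Prog.evalAt, polysVal_nil, evalAtList]
    exact ⟨rfl, by rw [List.length_nil]; omega⟩
  | cons f F ih =>
    have h₁ := hF f (by simp)
    refine Call.of_wp (body := Prog.evalAt) rfl ?_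
    simp only [wp, wpVar, wpCase, Prog.evalAt, polysVal_cons, evalAtList, Nat.cast_one]
    refine WpCall.intro (ih fun g hg => hF g (by simp [hg])) ?_
    refine WpCall.intro (shift_spec (List.replicate j .nil) _) ?_
    rw [List.length_replicate]
    refine WpCall.intro (axpy_spec _ _ _) ⟨rfl, ?_⟩
    simp only [List.length_cons]; nlinarith

/-- The queue keeps its length, and each step pays for appending one member at its end. -/
theorem divQueue_spec (q u : List (ZMod N)) :
    Call Prog.table 11 (.cons (polyVal q) (polyVal u)) (polyVal (divQueueList q u))
      ((u.length + 1) * (20 * q.length + 50)) := by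
  induction u generalizing q with
  | nil =>
    refine Call.of_wp (body := Prog.divQueue) rfl ?_
    simp only [wp, wpVar, wpCase, Prog.divQueue, polyVal_nil, divQueueList]
    exact ⟨trivial, by rw [List.length_nil]; omega⟩
  | cons a u ih =>
    refine Call.of_wp (body := Prog.divQueue) rfl ?_
    cases q with
    | nil =>
      simp only [wp, wpVar, wpCase, Prog.divQueue, polyVal_nil, polyVal_cons, divQueueList]
      simp; omega
    | cons c q =>
      simp only [wp, wpVar, wpCase, wpNum, Prog.divQueue, polyVal_cons, divQueueList]
      refine WpCall.intro (append_polyVal_spec q [c - a]) ?_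
      refine WpCall.intro (ih _) ⟨rfl, ?_⟩
      simp only [List.length_cons, List.length_append, List.length_nil]; nlinarith

theorem length_divQueueList_le {R : Type*} [CommRing R] (q u : List R) :
    (divQueueList q u).length ≤ u.length := by
  induction u generalizing q with
  | nil => simp [divQueueList]
  | cons a u ih =>
    cases q with
    | nil => simp [divQueueList]
    | cons c q => simpa [divQueueList] using ih _

theorem length_le_of_mem_dividedDiffsList {R : Type*} [CommRing R] {L : ℕ} {v : List R}
    (hv : v.length ≤ L) {ws : List (List R)} (hws : ∀ w ∈ ws, w.length ≤ L) {j : ℕ}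
    {w : List R} (hw : w ∈ dividedDiffsList v j ws) : w.length ≤ L := by
  induction ws generalizing j with
  | nil => simp [dividedDiffsList] at hw
  | cons u ws ih =>
    rw [dividedDiffsList, List.mem_cons] at hw
    rcases hw with rfl | hw
    · refine (length_divQueueList_le _ _).trans ?_
      rw [length_axpyList]
      exact max_le hv (hws _ (by simp))
    · exact ih (fun w hw => hws w (by simp [hw])) hw

theorem dividedDiffs_spec {L : ℕ} {v : List (ZMod N)} (hv : v.length ≤ L)
    {ws : List (List (ZMod N))} (hws : ∀ w ∈ ws, w.length ≤ L) (j : ℕ) :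
    Call Prog.table 12 (.cons (countVal N j) (.cons (polyVal v) (polysVal ws)))
      (polysVal (dividedDiffsList v j ws))
      ((ws.length + 1) * ((L + 1) * (40 * (j + ws.length) + 200))) := by
  induction ws generalizing j with
  | nil =>
    refine Call.of_wp (body := Prog.dividedDiffs) rfl ?_
    simp only [wp, wpVar, wpCase, Prog.dividedDiffs, polysVal_nil, dividedDiffsList]
    simp only [true_and, List.length_nil]; nlinarith
  | cons u ws ih =>
    have h₁ := hws u (by simp)
    refine Call.of_wp (body := Prog.dividedDiffs) rfl ?_
    simp only [wp, wpVar, wpCase, wpNum, Prog.dividedDiffs, polysVal_cons, dividedDiffsList,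
      Nat.cast_zero, Nat.cast_one, zero_sub]
    refine WpCall.intro (shift_spec (List.replicate j .nil) []) ?_
    refine WpCall.intro (axpy_spec _ _ _) ?_
    refine WpCall.intro (divQueue_spec _ _) ?_
    refine WpCall.intro (ih (fun w hw => hws w (by simp [hw])) (j + 1)) ⟨?_, ?_⟩
    · simp
    · simp only [List.length_cons, List.length_append, List.length_replicate, List.length_nil,
        length_axpyList, add_zero]
      have h₂ : (max v.length u.length + 1) * (20 * j + 50) ≤ (L + 1) * (20 * j + 50) :=
        Nat.mul_le_mul_right _ (by omega)
      have h₃ : j ≤ (L + 1) * j := Nat.le_mul_of_pos_left _ (by omega)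
      nlinarith

theorem length_extrapolateList_le {R : Type*} [CommRing R] {L : ℕ} (m : ℕ) {vs : List (List R)}
    (hvs : ∀ v ∈ vs, v.length ≤ L) : (extrapolateList m vs).length ≤ L + vs.length * m := by
  induction hn : vs.length generalizing m vs with
  | zero => rw [List.length_eq_zero_iff] at hn; simp [hn, extrapolateList]
  | succ n ih =>
    obtain ⟨v, vs, rfl⟩ := List.exists_cons_of_length_eq_add_one hn
    have h₁ := hvs v (by simp)
    have h₂ := ih (m - 1) (vs := dividedDiffsList v 1 vs)
      (fun w hw => length_le_of_mem_dividedDiffsList h₁ (fun w hw => hvs w (by simp [hw])) hw)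
      (by simpa [length_dividedDiffsList] using hn)
    have h₃ : n * (m - 1) ≤ n * m := Nat.mul_le_mul_left _ (by omega)
    simp only [extrapolateList, length_axpyList, List.length_append, List.length_replicate,
      add_mul]
    omega

/-- Exact division does not lengthen the lists, so every round of divided differences works with
length at most `L`. Only the extrapolated value grows, by at most `m` in each of the `vs.length`
rounds. -/
theorem extrapolate_spec {L : ℕ} (m : ℕ) {vs : List (List (ZMod N))}
    (hvs : ∀ v ∈ vs, v.length ≤ L) :
    Call Prog.table 13 (.cons (countVal N m) (polysVal vs)) (polyVal (extrapolateList m vs))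
      ((vs.length + 1) * ((vs.length + 1) * (L + 1) * (40 * vs.length + 300) +
        30 * (vs.length * m) + 30 * m)) := by
  induction hn : vs.length generalizing m vs with
  | zero =>
    rw [List.length_eq_zero_iff] at hn
    subst hn
    refine Call.of_wp (body := Prog.extrapolate) rfl ?_
    simp only [wp, wpVar, wpCase, Prog.extrapolate, polysVal_nil, extrapolateList]
    simp only [polyVal_nil, true_and]; nlinarith
  | succ n ih =>
    obtain ⟨v, vs, rfl⟩ := List.exists_cons_of_length_eq_add_one hn
    have h₁ := hvs v (by simp)
    have hws : ∀ w ∈ vs, w.length ≤ L := fun w hw => hvs w (by simp [hw])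
    have hlen : vs.length = n := by simpa using hn
    have hdd := fun w (hw : w ∈ dividedDiffsList v 1 vs) =>
      length_le_of_mem_dividedDiffsList h₁ hws hw
    have h₂ := ih (m - 1) hdd (by simpa [length_dividedDiffsList] using hlen)
    have h₃ : n * (m - 1) ≤ n * m := Nat.mul_le_mul_left _ (by omega)
    have h₄ := length_extrapolateList_le (m - 1) hdd
    have h₅ := dividedDiffs_spec h₁ hws 1
    rw [length_dividedDiffsList] at h₄
    rw [hlen] at h₄ h₅
    refine Call.of_wp (body := Prog.extrapolate) rfl ?_
    have key : 50 + (n + 1) * ((L + 1) * (40 * (1 + n) + 200)) +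
        (n + 1) * ((n + 1) * (L + 1) * (40 * n + 300) + 30 * (n * (m - 1)) + 30 * (m - 1)) +
        20 * (m + 1) + 30 * ((extrapolateList (m - 1) (dividedDiffsList v 1 vs)).length + 1) +
        30 * (v.length + 1) ≤ (n + 1 + 1) * ((n + 1 + 1) * (L + 1) * (40 * (n + 1) + 300) +
        30 * ((n + 1) * m) + 30 * m) := by
      have h₆ : (n + 1) * ((n + 1) * (L + 1) * (40 * n + 300) + 30 * (n * (m - 1)) +
          30 * (m - 1)) ≤ (n + 1) * ((n + 1) * (L + 1) * (40 * n + 300) + 30 * (n * m) + 30 * m) :=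
        Nat.mul_le_mul_left _ (by omega)
      nlinarith [Nat.zero_le (n * L)]
    have h₈ := shift_spec (List.replicate m (Val.nil : Val N))
      (extrapolateList (m - 1) (dividedDiffsList v 1 vs))
    rw [List.length_replicate] at h₈
    -- The program finds `m - 1` by inspecting the counter, which reduces differently for zero and
    -- for a successor.
    rcases m with _ | m <;>
    · simp only [wp, wpVar, wpCase, wpNum, Prog.extrapolate, polysVal_cons, extrapolateList,
    countVal_succ, countVal_zero, Nat.cast_zero, Nat.cast_one, zero_sub]
      refine WpCall.intro h₅ ?_
      refine WpCall.intro h₂ ?_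
      refine WpCall.intro h₈ ?_
      refine WpCall.intro (axpy_spec _ _ _) ?_
      refine WpCall.intro (axpy_spec _ _ _) ⟨rfl, ?_⟩
      omega

theorem mulCount_spec (a b : ℕ) :
    Call Prog.table 14 (.cons (countVal N a) (countVal N b)) (countVal N (a * b))
      ((a + 1) * (20 * b + 40)) := by
  induction a with
  | zero =>
    refine Call.of_wp (body := Prog.mulCount) rfl ?_
    simp only [wp, wpVar, wpCase, Prog.mulCount, countVal_zero]
    simp only [zero_mul, countVal_zero, true_and]; omega
  | succ a ih =>
    refine Call.of_wp (body := Prog.mulCount) rfl ?_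
    simp only [wp, wpVar, wpCase, Prog.mulCount, countVal_succ]
    refine WpCall.intro ih ?_
    refine WpCall.intro (append_spec _ _) ⟨?_, ?_⟩
    · rw [List.replicate_append_replicate, add_mul, one_mul, add_comm b]; rfl
    · simp only [List.length_replicate]; nlinarith

theorem append_countVal_spec (a b : ℕ) :
    Call Prog.table 6 (.cons (countVal N a) (countVal N b)) (countVal N (a + b))
      (20 * (a + 1)) := by
  have := append_spec (List.replicate a (Val.nil : Val N)) (List.replicate b .nil)
  rwa [List.replicate_append_replicate, List.length_replicate] at this

theorem evens_spec (l : List (Val N)) :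
    Call Prog.table 16 (listVal l) (listVal (evensList l)) (20 * (l.length + 1)) := by
  induction l using evensList.induct with
  | case1 =>
    refine Call.of_wp (body := Prog.evens) rfl ?_
    simp only [wp, wpVar, wpCase, Prog.evens, listVal_nil, evensList]
    simp
  | case2 a =>
    refine Call.of_wp (body := Prog.evens) rfl ?_
    simp only [wp, wpVar, wpCase, Prog.evens, listVal_nil, listVal_cons, evensList]
    simp
  | case3 a b l ih =>
    refine Call.of_wp (body := Prog.evens) rfl ?_
    simp only [wp, wpVar, wpCase, Prog.evens, listVal_cons, evensList]
    refine WpCall.intro ih ⟨rfl, ?_⟩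
    simp only [List.length_cons]; omega

theorem reverse_spec (f g : List (ZMod N)) :
    Call Prog.table 19 (.cons (polyVal f) (polyVal g)) (polyVal (f.reverse ++ g))
      (20 * (f.length + 1)) := by
  induction f generalizing g with
  | nil =>
    refine Call.of_wp (body := Prog.reverse) rfl ?_
    simp only [wp, wpVar, wpCase, Prog.reverse, polyVal_nil]
    simp
  | cons a f ih =>
    refine Call.of_wp (body := Prog.reverse) rfl ?_
    simp only [wp, wpVar, wpCase, Prog.reverse, polyVal_cons]
    refine WpCall.intro (ih (a :: g)) ⟨?_, ?_⟩
    · simp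
    · simp only [List.length_cons]; omega

end Specs

/-! ### Coefficient lists and polynomials -/

section Polynomials

variable {R : Type*} [CommRing R]

/-- The polynomial with a given coefficient list. -/
noncomputable def ofList : List R → R[X]
  | [] => 0
  | a :: l => C a + X * ofList l

/-- The first `n` coefficients of a polynomial. -/
noncomputable def coeffList (n : ℕ) (p : R[X]) : List R := (List.range n).map p.coeff

theorem length_coeffList (n : ℕ) (p : R[X]) : (coeffList n p).length = n := by
  simp [coeffList]

theorem coeff_ofList (l : List R) (i : ℕ) : (ofList l).coeff i = l.getD i 0 := by
  induction l generalizing i with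
  | nil => simp [ofList]
  | cons a l ih =>
    cases i with
    | zero => simp [ofList]
    | succ i => rw [ofList, coeff_add, coeff_X_mul, ih, coeff_C_succ]; simp

theorem degree_ofList_lt (l : List R) : (ofList l).degree < l.length := by
  rw [degree_lt_iff_coeff_zero]
  intro i hi
  rw [coeff_ofList, List.getD_eq_default _ _ (by exact_mod_cast hi)]

theorem ofList_coeffList {n : ℕ} {p : R[X]} (hp : p.degree < n) : ofList (coeffList n p) = p := by
  ext i
  rw [coeff_ofList]
  rcases lt_or_ge i n with h | h
  · rw [List.getD_eq_getElem _ _ (by simpa [length_coeffList])]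
    simp [coeffList]
  · rw [List.getD_eq_default _ _ (by simpa [length_coeffList]),
      (degree_lt_iff_coeff_zero _ _).1 hp i (by exact_mod_cast h)]

theorem coeffList_succ (n : ℕ) (a : R) (p : R[X]) :
    coeffList (n + 1) (C a + X * p) = a :: coeffList n p := by
  rw [coeffList, List.range_succ_eq_map, List.map_cons, List.map_map]
  congr 1
  · simp
  · apply List.map_congr_left
    intro i _
    simp [coeff_X_mul]

/-- Through this, equality of lists produced by the program reduces to equality of polynomials:
trailing zeros of intermediate lists are immaterial once the result is fitted to a prescribed
length. -/
theorem fitList_eq (n : ℕ) (l : List R) : fitList n l = coeffList n (ofList l) := by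
  induction n generalizing l with
  | zero => rfl
  | succ n ih =>
    cases l with
    | nil =>
      have := coeffList_succ n (0 : R) 0
      rw [C_0, mul_zero, add_zero] at this
      rw [fitList, ih, ofList, this]
    | cons a l => rw [fitList, ih, ofList, coeffList_succ]

theorem ofList_axpyList (c : R) (f g : List R) :
    ofList (axpyList c f g) = C c * ofList f + ofList g := by
  induction f generalizing g with
  | nil => simp [axpyList, ofList]
  | cons a f ih =>
    cases g <;> simp only [axpyList, ofList, ih, C_add, C_mul] <;> ring

theorem ofList_append (f g : List R) :
    ofList (f ++ g) = ofList f + X ^ f.length * ofList g := by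
  induction f with
  | nil => simp [ofList]
  | cons a f ih => simp only [List.cons_append, ofList, ih, List.length_cons]; ring

theorem ofList_replicate_zero (j : ℕ) : ofList (List.replicate j (0 : R)) = 0 := by
  induction j with
  | zero => rfl
  | succ j ih => simp [List.replicate_succ, ofList, ih]

theorem ofList_replicate_append (j : ℕ) (f : List R) :
    ofList (List.replicate j 0 ++ f) = X ^ j * ofList f := by
  rw [ofList_append, ofList_replicate_zero, List.length_replicate, zero_add]

theorem ofList_schoolMulList (f g : List R) :
    ofList (schoolMulList f g) = ofList f * ofList g := by
  induction f with
  | nil => simp [schoolMulList, ofList]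
  | cons a f ih => simp only [schoolMulList, ofList_axpyList, ofList, ih, C_0]; ring

theorem ofList_evalAtList (j : ℕ) (F : List (List R)) :
    ofList (evalAtList j F) = (ofList (F.map ofList)).eval (X ^ j) := by
  induction F with
  | nil => simp [evalAtList, ofList]
  | cons f F ih =>
    simp only [evalAtList, ofList_axpyList, ofList_replicate_append, ih, List.map_cons, ofList,
      eval_add, eval_C, eval_mul, eval_X, C_1, one_mul]

theorem eval_ofList_chunksList {m : ℕ} (hm : 0 < m) (l : List R) :
    (ofList ((chunksList m l).map ofList)).eval (X ^ m) = ofList l := by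
  induction hn : l.length using Nat.strong_induction_on generalizing l with
  | _ n ih =>
    subst hn
    cases l with
    | nil => simp [chunksList, ofList]
    | cons a l =>
      have h := ih _ (by simp only [List.length_drop, List.length_cons]; omega)
        ((a :: l).drop m) rfl
      rw [chunksList_cons hm, List.map_cons]
      conv_rhs => rw [← List.take_append_drop m (a :: l), ofList_append]
      rw [ofList, eval_add, eval_C, eval_mul, eval_X, h, List.length_take]
      -- Only the last block can be shorter than `m`, and then nothing follows whose exponent could
      -- be wrong.
      rcases le_total m (a :: l).length with h | h
      · rw [min_eq_left h]
      · rw [List.drop_eq_nil_of_le h]; simp [ofList]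

/-- If `W * (X^j - 1) = u`, the coefficients satisfy `W_i = W_(i - j) - u_i`, so the last `j` of
them suffice to continue. The hypothesis is this recursion with an arbitrary queue `q`, as the
induction needs. When `u` is exhausted, `W * (1 - X^j) = q` with `q` of degree below `j` forces `W =
0`; exactness of the division enters here. -/
theorem ofList_divQueueList {q u : List R} (hq : q ≠ []) {W : R[X]}
    (hW : W = ofList q - ofList u + X ^ q.length * W) : ofList (divQueueList q u) = W := by
  induction u generalizing q W with
  | nil =>
    have h : ofList q = (-W) * (X ^ q.length - 1) := by
      rw [ofList] at hW; linear_combination -hW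
    rcases subsingleton_or_nontrivial R with _ | _
    · exact Subsingleton.elim _ _
    have hmon : (X ^ q.length - 1 : R[X]).Monic :=
      monic_X_pow_sub_C 1 (by simpa using hq)
    have h₀ : -W = 0 := by
      by_contra h₀
      have hd := degree_ofList_lt q
      rw [h, hmon.degree_mul, ← C_1, degree_X_pow_sub_C (by simpa [List.length_pos_iff] using hq)]
        at hd
      have : (0 : WithBot ℕ) ≤ (-W).degree := zero_le_degree_iff.2 h₀
      have h₂ : (0 : WithBot ℕ) + (q.length : WithBot ℕ) ≤ (-W).degree + q.length := by gcongr
      rw [zero_add] at h₂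
      exact absurd hd (not_lt.2 h₂)
    rw [neg_eq_zero] at h₀
    rw [divQueueList, h₀]; rfl
  | cons a u ih =>
    obtain ⟨c, q, rfl⟩ := List.exists_cons_of_ne_nil hq
    rw [divQueueList, ofList]
    have h₀ : W.coeff 0 = c - a := by
      rw [hW]; simp [ofList]
    have h₁ : W = C (c - a) + X * W.divX := by
      rw [← h₀, add_comm]; exact (X_mul_divX_add W).symm
    -- Without its constant term, `W` satisfies the same equation with the advanced queue.
    have h₂ : ofList (divQueueList (q ++ [c - a]) u) = W.divX := by
      refine ih (by simp) ?_
      have h₃ : X * W.divX = X * (ofList (q ++ [c - a]) - ofList u +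
          X ^ (q ++ [c - a]).length * W.divX) := by
        simp only [ofList_append, List.length_append, List.length_cons, List.length_nil, ofList]
          at hW ⊢
        rw [C_sub] at h₁ ⊢
        linear_combination hW - (1 - X ^ (q.length + 1)) * h₁
      exact monic_X.isRegular.left h₃
    rw [h₂]; exact h₁.symm

theorem ofList_dividedDiffsList {v : List R} {ws : List (List R)} {j : ℕ} (hj : 0 < j)
    {K : ℕ → R[X]}
    (h : ∀ i (hi : i < ws.length), ofList ws[i] = ofList v + (X ^ (j + i) - 1) * K i) :
    ∀ i (hi : i < (dividedDiffsList v j ws).length),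
      ofList (dividedDiffsList v j ws)[i] = K i := by
  induction ws generalizing j K with
  | nil => intro i hi; simp [dividedDiffsList] at hi
  | cons w ws ih =>
    intro i hi
    cases i with
    | zero =>
      have h₀ := h 0 (by simp)
      simp only [dividedDiffsList, List.getElem_cons_zero]
      apply ofList_divQueueList (by simpa using hj.ne')
      rw [ofList_replicate_zero, ofList_axpyList, List.length_replicate, C_neg, C_1]
      simp only [List.getElem_cons_zero, add_zero] at h₀
      linear_combination h₀
    | succ i =>
      simp only [dividedDiffsList, List.getElem_cons_succ]
      refine ih (j := j + 1) (K := fun i => K (i + 1)) (by omega) ?_ i _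
      intro i hi
      have := h (i + 1) (by simpa using hi)
      rw [List.getElem_cons_succ] at this
      rw [this]
      ring_nf

/-- Newton interpolation at the powers of `X`, evaluated at `X ^ m`. -/
theorem ofList_extrapolateList {m : ℕ} {vs : List (List R)} {H : R[X][X]}
    (hH : H.degree < vs.length)
    (h : ∀ i (hi : i < vs.length), ofList vs[i] = H.eval (X ^ i)) :
    ofList (extrapolateList m vs) = H.eval (X ^ m) := by
  induction hn : vs.length generalizing m vs H with
  | zero =>
    rw [List.length_eq_zero_iff] at hn
    subst hn
    have : H = 0 := by
      rw [← degree_eq_bot]; simpa [Nat.WithBot.lt_zero_iff] using hH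
    simp [extrapolateList, ofList, this]
  | succ n ih =>
    obtain ⟨v, vs, rfl⟩ := List.exists_cons_of_length_eq_add_one hn
    have hlen : vs.length = n := by simpa using hn
    rcases subsingleton_or_nontrivial R with _ | _
    · exact Subsingleton.elim _ _
    -- Division by the monic `Y - 1` needs no inverses; `K` is the divided difference of `H` at the
    -- node `1`.
    set K : R[X][X] := H /ₘ (X - C 1) with hK
    have hv : ofList v = H.eval 1 := (h 0 (by simp)).trans (by rw [pow_zero])
    have hdiv : ∀ x, H.eval x = ofList v + (x - 1) * K.eval x := by
      intro x
      have := congrArg (eval x) (modByMonic_add_div H (X - C (1 : R[X])))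
      rw [modByMonic_X_sub_C_eq_C_eval, ← hv] at this
      simpa [hK] using this.symm
    have hKdeg : K.degree < n := by
      rcases eq_or_ne K 0 with h₀ | h₀
      · rw [h₀, degree_zero]; exact WithBot.bot_lt_coe n
      · rw [degree_eq_natDegree h₀, Nat.cast_lt]
        have h₁ := natDegree_divByMonic H (monic_X_sub_C (1 : R[X]))
        rw [natDegree_X_sub_C] at h₁
        have h₂ : H ≠ 0 := by rintro rfl; simp [hK] at h₀
        rw [degree_eq_natDegree h₂, hn, Nat.cast_lt] at hH
        rw [← hK] at h₁
        have h₃ : n ≠ 0 := by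
          rintro rfl
          apply h₀
          rw [hK, divByMonic_eq_zero_iff (monic_X_sub_C _), degree_X_sub_C,
            degree_eq_natDegree h₂]
          exact_mod_cast hH
        omega
    -- `K` is known at `X, X^2, …`. Substituting `X * Y` for `Y` moves these nodes to `1, X, …`,
    -- which is the situation of the induction hypothesis.
    have hK' : ofList (extrapolateList (m - 1) (dividedDiffsList v 1 vs)) =
        (K.comp (C X * X)).eval (X ^ (m - 1)) := by
      refine ih ?_ ?_ (by rw [length_dividedDiffsList, hlen])
      · rw [length_dividedDiffsList, hlen, degree_lt_iff_coeff_zero]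
        intro i hi
        rw [comp_C_mul_X_coeff, (degree_lt_iff_coeff_zero _ _).1 hKdeg i (by exact_mod_cast hi),
          zero_mul]
      · apply ofList_dividedDiffsList (j := 1) one_pos
        intro i hi
        have := h (i + 1) (by simpa using hi)
        rw [List.getElem_cons_succ, hdiv] at this
        rw [this, eval_comp, add_comm 1 i]
        simp [pow_succ']
    simp only [extrapolateList, ofList_axpyList, ofList_replicate_append, hK', hdiv, C_neg, C_1]
    rw [eval_comp]
    -- For `m = 0` the shift to `m - 1` fails, but the factor `X^m - 1` vanishes.
    cases m with
    | zero => simp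
    | succ m =>
      simp only [add_tsub_cancel_right, eval_mul, eval_C, eval_X, ← pow_succ']
      ring

end Polynomials

/-! ### Fast multiplication -/

/-- With the block sizes `ms`, polynomials with `n ≤ L` coefficients in total are multiplied in at
most `A * (n + 1)` steps. -/
inductive BlockSizes : List ℕ → ℕ → ℕ → Prop where
  | nil {L A : ℕ} : 200 * (L + 1) ≤ A → BlockSizes [] L A
  -- `L + 2 * m ≤ P * m` bounds the number of blocks of both factors by `P`. `P * P ≤ m` keeps the
  -- values at `X^j` with `j ≤ P` within length `2 * m`, so the products at the points have total
  -- length at most `4 * m` and are left to `ms`.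
  | cons {m : ℕ} {ms : List ℕ} {L A A' P : ℕ} : 0 < m → P * P ≤ m → L + 2 * m ≤ P * m →
      BlockSizes ms (4 * m) A → 20 * A + 10000 * ((P + 1) * (P + 1)) ≤ A' →
      BlockSizes (m :: ms) L A'

theorem BlockSizes.mono {ms : List ℕ} {L L' A A' : ℕ} (h : BlockSizes ms L A) (hL : L' ≤ L)
    (hA : A ≤ A') : BlockSizes ms L' A' := by
  cases h with
  | nil h₁ => exact .nil (by omega)
  | cons h₁ h₂ h₃ h₄ h₅ => exact .cons h₁ h₂ (by omega) h₄ (h₅.trans hA)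

section

variable {N : ℕ}

/-- The list of block sizes as a datum. -/
def sizesVal (N : ℕ) (ms : List ℕ) : Val N := listVal (ms.map (countVal N))

theorem sizesVal_nil : sizesVal N [] = .nil := rfl

theorem sizesVal_cons (m : ℕ) (ms : List ℕ) :
    sizesVal N (m :: ms) = .cons (countVal N m) (sizesVal N ms) := rfl

/-- The coefficient list of the product of two polynomials. -/
noncomputable def mulList {R : Type*} [CommRing R] (f g : List R) : List R :=
  coeffList (f.length + g.length) (ofList f * ofList g)

theorem length_mulList {R : Type*} [CommRing R] (f g : List R) :
    (mulList f g).length = f.length + g.length := length_coeffList _ _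

theorem degree_ofList_mul_lt {R : Type*} [CommRing R] (f g : List R) :
    (ofList f * ofList g).degree < ((f.length + g.length : ℕ) : WithBot ℕ) := by
  rcases eq_or_ne (ofList f) 0 with h | h
  · rw [h, zero_mul, degree_zero]; exact WithBot.bot_lt_coe _
  refine (degree_mul_le _ _).trans_lt ?_
  have h₁ := degree_ofList_lt f
  have h₂ := degree_ofList_lt g
  rcases eq_or_ne (ofList g) 0 with h' | h'
  · rw [h', degree_zero, WithBot.add_bot]; exact WithBot.bot_lt_coe _
  rw [degree_eq_natDegree h, Nat.cast_lt] at h₁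
  rw [degree_eq_natDegree h', Nat.cast_lt] at h₂
  rw [degree_eq_natDegree h, degree_eq_natDegree h']
  exact_mod_cast add_lt_add h₁ h₂

theorem ofList_mulList {R : Type*} [CommRing R] (f g : List R) :
    ofList (mulList f g) = ofList f * ofList g :=
  ofList_coeffList (degree_ofList_mul_lt f g)

/-- The products of the values at `X ^ j`, …, `X ^ (j + n - 1)`. -/
noncomputable def pointProductsList {R : Type*} [CommRing R] (F G : List (List R)) :
    ℕ → ℕ → List (List R)
  | _, 0 => []
  | j, n + 1 => mulList (evalAtList j F) (evalAtList j G) :: pointProductsList F G (j + 1) n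

theorem length_pointProductsList {R : Type*} [CommRing R] (F G : List (List R)) (j n : ℕ) :
    (pointProductsList F G j n).length = n := by
  induction n generalizing j with
  | zero => rfl
  | succ n ih => simp [pointProductsList, ih]

theorem getElem_pointProductsList {R : Type*} [CommRing R] (F G : List (List R)) (j n i : ℕ)
    (hi : i < (pointProductsList F G j n).length) :
    (pointProductsList F G j n)[i] =
      mulList (evalAtList (j + i) F) (evalAtList (j + i) G) := by
  induction n generalizing j i with
  | zero => simp [pointProductsList] at hi
  | succ n ih =>
    cases i with
    | zero => simp [pointProductsList]
    | succ i =>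
      simp only [pointProductsList, List.getElem_cons_succ]
      rw [ih, add_assoc, add_comm 1 i]

theorem length_evalAtList_le_two_mul {R : Type*} [CommRing R] {m P j : ℕ} {F : List (List R)}
    (hF : ∀ f ∈ F, f.length ≤ m) (hP : P * P ≤ m) (hj : j ≤ P) (hl : F.length ≤ P) :
    (evalAtList j F).length ≤ 2 * m := by
  have h₁ := length_evalAtList_le j hF
  have h₂ : j * F.length ≤ P * P := Nat.mul_le_mul hj hl
  omega

theorem length_le_of_mem_pointProductsList {R : Type*} [CommRing R] {m P j n : ℕ}
    {F G : List (List R)} (hF : ∀ f ∈ F, f.length ≤ m) (hG : ∀ f ∈ G, f.length ≤ m)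
    (hP : P * P ≤ m) (hj : j + n ≤ P) (hl : F.length + G.length ≤ P) {v : List R}
    (hv : v ∈ pointProductsList F G j n) : v.length ≤ 4 * m := by
  obtain ⟨i, hi, rfl⟩ := List.getElem_of_mem hv
  rw [getElem_pointProductsList, length_mulList]
  rw [length_pointProductsList] at hi
  have h₁ := length_evalAtList_le_two_mul (j := j + i) hF hP (by omega) (by omega)
  have h₂ := length_evalAtList_le_two_mul (j := j + i) hG hP (by omega) (by omega)
  omega

theorem pointProducts_spec {ms : List ℕ} {m P T : ℕ}
    (hmul : ∀ f g : List (ZMod N), f.length + g.length ≤ 4 * m →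
      Call Prog.table 10 (.cons (sizesVal N ms) (.cons (polyVal f) (polyVal g)))
        (polyVal (mulList f g)) T)
    {F G : List (List (ZMod N))} (hF : ∀ f ∈ F, f.length ≤ m) (hG : ∀ f ∈ G, f.length ≤ m)
    (hP : P * P ≤ m) (hl : F.length + G.length ≤ P) (c : List (Val N)) (j : ℕ)
    (hj : j + c.length ≤ P) :
    Call Prog.table 9 (.cons (sizesVal N ms) (.cons (countVal N j) (.cons (listVal c)
      (.cons (polysVal F) (polysVal G))))) (polysVal (pointProductsList F G j c.length))
      ((c.length + 1) * (T + (P + 2) * (30 * m + 20 * P + 100) + 100)) := by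
  induction c generalizing j with
  | nil =>
    refine Call.of_wp (body := Prog.pointProducts) rfl ?_
    simp only [wp, wpVar, wpCase, Prog.pointProducts, listVal_nil]
    refine ⟨rfl, ?_⟩
    rw [List.length_nil]; nlinarith
  | cons a c ih =>
    rw [List.length_cons] at hj
    refine Call.of_wp (body := Prog.pointProducts) rfl ?_
    simp only [wp, wpVar, wpCase, Prog.pointProducts, listVal_cons]
    refine WpCall.intro (evalAt_spec j hF) ?_
    refine WpCall.intro (evalAt_spec j hG) ?_
    have h₁ := length_evalAtList_le_two_mul (j := j) hF hP (by omega) (by omega)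
    have h₂ := length_evalAtList_le_two_mul (j := j) hG hP (by omega) (by omega)
    refine WpCall.intro (hmul _ _ (by omega)) ?_
    refine WpCall.intro (ih (j + 1) (by omega)) ⟨rfl, ?_⟩
    rw [List.length_cons]
    have h₃ : (F.length + 1) * (30 * m + 20 * j + 100) + (G.length + 1) * (30 * m + 20 * j + 100)
        ≤ (P + 2) * (30 * m + 20 * P + 100) := by
      rw [← add_mul]; exact Nat.mul_le_mul (by omega) (by omega)
    rw [add_mul (c.length + 1)]
    omega

/-- The product of the two block polynomials has `Y`-degree below the total number of blocks, which
is the number of points, so the interpolation is exact; the value at `X^m` undoes the cutting. -/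
theorem fitList_extrapolateList_eq {R : Type*} [CommRing R] {m : ℕ} (hm : 0 < m) (f g : List R) :
    fitList (f.length + g.length) (extrapolateList m (pointProductsList (chunksList m f)
      (chunksList m g) 0 ((chunksList m f).length + (chunksList m g).length))) = mulList f g := by
  rw [fitList_eq, mulList]
  congr 1
  rw [ofList_extrapolateList (H := ofList ((chunksList m f).map ofList) *
    ofList ((chunksList m g).map ofList)), eval_mul, eval_ofList_chunksList hm,
    eval_ofList_chunksList hm]
  · have := degree_ofList_mul_lt ((chunksList m f).map ofList) ((chunksList m g).map ofList)
    rw [List.length_map, List.length_map] at this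
    rwa [length_pointProductsList]
  · intro i hi
    rw [getElem_pointProductsList, ofList_mulList, ofList_evalAtList, ofList_evalAtList, zero_add,
      eval_mul]

/-- Everything follows from `(p + 1) * m ≤ 4 * n`. The recursive products cost at most `5 * A * m`
each, hence `20 * A * n` together; evaluation and extrapolation contribute `O(n * P^2)`. -/
theorem toom_cost {m P A p n : ℕ} (hm : 0 < m) (hP : P * P ≤ m) (hp : p ≤ P)
    (hpm : p * m ≤ n + 2 * m) (hn : m < n) :
    300 * (n + 1) + 20 * p + (p + 1) * (A * (4 * m + 1) + (P + 2) * (30 * m + 20 * P + 100) + 100) +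
      (p + 1) * ((p + 1) * (4 * m + 1) * (40 * p + 300) + 30 * (p * m) + 30 * m) + 100 ≤
      (20 * A + 10000 * ((P + 1) * (P + 1))) * (n + 1) := by
  have h₁ : (p + 1) * m ≤ 4 * n := by rw [add_mul]; omega
  have h₂ : P ≤ m := by nlinarith
  have h₃ : (p + 1) * (A * (4 * m + 1)) ≤ 20 * A * n := by
    calc (p + 1) * (A * (4 * m + 1)) ≤ (p + 1) * (A * (5 * m)) := by gcongr; omega
      _ = 5 * A * ((p + 1) * m) := by ring
      _ ≤ 5 * A * (4 * n) := by gcongr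
      _ = 20 * A * n := by ring
  have h₄ : (p + 1) * ((P + 2) * (30 * m + 20 * P + 100) + 100) ≤ 800 * n * (P + 2) := by
    calc (p + 1) * ((P + 2) * (30 * m + 20 * P + 100) + 100)
        ≤ (p + 1) * ((P + 2) * (150 * m) + (P + 2) * (50 * m)) := by
          gcongr
          · omega
          · nlinarith
      _ = 200 * (P + 2) * ((p + 1) * m) := by ring
      _ ≤ 200 * (P + 2) * (4 * n) := by gcongr
      _ = 800 * n * (P + 2) := by ring
  have h₅ : (p + 1) * ((p + 1) * (4 * m + 1) * (40 * p + 300) + 30 * (p * m) + 30 * m) ≤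
      n * (6000 * ((P + 1) * (P + 1)) + 120 * (P + 1)) := by
    calc (p + 1) * ((p + 1) * (4 * m + 1) * (40 * p + 300) + 30 * (p * m) + 30 * m)
        ≤ (p + 1) * ((P + 1) * (5 * m) * (300 * (P + 1)) + 30 * (P * m) + 30 * m) := by
          gcongr <;> omega
      _ = ((p + 1) * m) * (1500 * ((P + 1) * (P + 1)) + 30 * (P + 1)) := by ring
      _ ≤ (4 * n) * (1500 * ((P + 1) * (P + 1)) + 30 * (P + 1)) := by gcongr
      _ = n * (6000 * ((P + 1) * (P + 1)) + 120 * (P + 1)) := by ring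
  have h₆ : n * (P + 1) ≤ n * ((P + 1) * (P + 1)) := by gcongr; nlinarith
  have h₇ : n ≤ n * (P + 1) := Nat.le_mul_of_pos_right _ (by omega)
  have h₈ : p < n := by omega
  nlinarith

/-- Induction on the block sizes: the products at the points belong to the tail of the list, with
its smaller constant `A`. An input of length at most `m` is passed on to the tail unchanged. -/
theorem mul_spec {ms : List ℕ} {L A : ℕ} (h : BlockSizes ms L A) (f g : List (ZMod N))
    (hL : f.length + g.length ≤ L) :
    Call Prog.table 10 (.cons (sizesVal N ms) (.cons (polyVal f) (polyVal g)))
      (polyVal (mulList f g)) (A * (f.length + g.length + 1)) := by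
  induction h generalizing f g with
  | @nil L A hA =>
    refine Call.of_wp (body := Prog.mul) rfl ?_
    simp only [wp, wpVar, wpCase, Prog.mul, sizesVal_nil]
    have hfit := fit_spec ((f ++ g).map Val.num) (schoolMulList f g)
    rw [List.length_map, List.length_append] at hfit
    refine WpCall.intro (append_polyVal_spec f g) ?_
    refine WpCall.intro (schoolMul_spec f g) ?_
    refine WpCall.intro hfit ⟨?_, ?_⟩
    · rw [mulList, ← ofList_schoolMulList, ← fitList_eq]
    · have h₁ : (f.length + 1) * (g.length + 1) ≤ (L + 1) * (f.length + g.length + 1) :=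
        Nat.mul_le_mul (by omega) (by omega)
      have h₂ := Nat.mul_le_mul_right (f.length + g.length + 1) hA
      nlinarith
  | @cons m ms L A A' P hm hP hLP hms hA' ih =>
    refine Call.mono ?_ (Nat.mul_le_mul_right _ hA')
    refine Call.of_wp (body := Prog.mul) rfl ?_
    simp only [wp, wpVar, wpCase, Prog.mul, sizesVal_cons]
    refine WpCall.intro (append_polyVal_spec f g) ?_
    refine WpCall.intro (drop_polyVal_spec (List.replicate m .nil) (f ++ g)) ?_
    rw [List.length_replicate, List.length_append]
    rcases le_or_gt (f.length + g.length) m with hn | hn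
    · rw [List.drop_eq_nil_of_le (by simpa using hn), polyVal_nil]
      simp only
      refine WpCall.intro (ih f g (by omega)) ⟨rfl, ?_⟩
      have h₁ : (A + 100) * (f.length + g.length + 1) ≤
          (20 * A + 10000 * ((P + 1) * (P + 1))) * (f.length + g.length + 1) :=
        Nat.mul_le_mul_right _ (by nlinarith)
      rw [add_mul] at h₁
      omega
    · obtain ⟨x, l, hx⟩ := List.exists_cons_of_ne_nil
        (l := (f ++ g).drop m) (by simpa [List.drop_eq_nil_iff] using hn)
      rw [hx, polyVal_cons]
      simp only
      have ha := length_mul_chunksList_le hm f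
      have hb := length_mul_chunksList_le hm g
      have hpm : ((chunksList m f).length + (chunksList m g).length) * m ≤
        f.length + g.length + 2 * m := by rw [add_mul]; omega
      have hp : (chunksList m f).length + (chunksList m g).length ≤ P :=
        Nat.le_of_mul_le_mul_right (by omega) hm
      have hF : ∀ u ∈ chunksList m f, u.length ≤ m := fun u => length_le_of_mem_chunksList hm
      have hG : ∀ u ∈ chunksList m g, u.length ≤ m := fun u => length_le_of_mem_chunksList hm
      have hmul : ∀ u v : List (ZMod N), u.length + v.length ≤ 4 * m →
          Call Prog.table 10 (.cons (sizesVal N ms) (.cons (polyVal u) (polyVal v)))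
            (polyVal (mulList u v)) (A * (4 * m + 1)) := fun u v huv =>
        (ih u v huv).mono (Nat.mul_le_mul_left _ (by omega))
      have happ := append_spec ((chunksList m f).map polyVal) ((chunksList m g).map polyVal)
      have hpp := pointProducts_spec hmul hF hG hP hp
        ((chunksList m f).map polyVal ++ (chunksList m g).map polyVal) 0 (by simpa using hp)
      rw [List.length_append, List.length_map, List.length_map] at hpp
      rw [List.length_map] at happ
      have hex := extrapolate_spec m (fun v hv =>
        length_le_of_mem_pointProductsList (j := 0)
          (n := (chunksList m f).length + (chunksList m g).length) hF hG hP (by simpa using hp)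
          hp hv)
      have hfit := fit_spec ((f ++ g).map Val.num) (extrapolateList m
        (pointProductsList (chunksList m f) (chunksList m g) 0
          ((chunksList m f).length + (chunksList m g).length)))
      rw [length_pointProductsList] at hex
      rw [List.length_map, List.length_append, fitList_extrapolateList_eq hm] at hfit
      refine WpCall.intro (chunks_spec hm f) ?_
      refine WpCall.intro (chunks_spec hm g) ?_
      refine WpCall.intro (append_polyVal_spec f g) ?_
      refine WpCall.intro happ ?_
      refine WpCall.intro hpp ?_
      refine WpCall.intro hex ?_
      refine WpCall.intro hfit ⟨rfl, ?_⟩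
      refine le_trans ?_ (toom_cost hm hP hp hpm hn)
      omega

end

/-! ### Products of linear factors, power series inversion and multipoint evaluation -/

section Polynomials

variable {R : Type*} [CommRing R]

/-- The monic polynomial with the given roots. -/
noncomputable def rootsPoly (S : List R) : R[X] := (S.map fun s => X - C s).prod

theorem rootsPoly_append (S T : List R) : rootsPoly (S ++ T) = rootsPoly S * rootsPoly T := by
  simp [rootsPoly]

theorem monic_rootsPoly (S : List R) : (rootsPoly S).Monic := by
  induction S with
  | nil => simp [rootsPoly]
  | cons s S ih =>
    rw [rootsPoly, List.map_cons, List.prod_cons]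
    exact (monic_X_sub_C s).mul ih

theorem natDegree_rootsPoly [Nontrivial R] (S : List R) :
    (rootsPoly S).natDegree = S.length := by
  induction S with
  | nil => simp [rootsPoly]
  | cons s S ih =>
    rw [rootsPoly, List.map_cons, List.prod_cons]
    change ((X - C s) * rootsPoly S).natDegree = _
    rw [(monic_X_sub_C s).natDegree_mul (monic_rootsPoly S), natDegree_X_sub_C, ih,
      List.length_cons, add_comm]

theorem degree_rootsPoly_lt (S : List R) :
    (rootsPoly S).degree < ((S.length + 1 : ℕ) : WithBot ℕ) := by
  rcases subsingleton_or_nontrivial R with _ | _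
  · rw [Subsingleton.elim (rootsPoly S) 0, degree_zero]; exact WithBot.bot_lt_coe _
  · rw [degree_eq_natDegree (monic_rootsPoly S).ne_zero, natDegree_rootsPoly, Nat.cast_lt]
    exact Nat.lt_succ_self _

/-- The coefficients of the monic polynomial with the given roots. -/
noncomputable def rootsList (S : List R) : List R := coeffList (S.length + 1) (rootsPoly S)

theorem length_rootsList (S : List R) : (rootsList S).length = S.length + 1 := length_coeffList _ _

theorem ofList_rootsList (S : List R) : ofList (rootsList S) = rootsPoly S :=
  ofList_coeffList (degree_rootsPoly_lt S)

theorem coeff_ofList_coeffList {n i : ℕ} (p : R[X]) (hi : i < n) :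
    (ofList (coeffList n p)).coeff i = p.coeff i := by
  rw [coeff_ofList, List.getD_eq_getElem _ _ (by simpa [length_coeffList])]
  simp [coeffList]

theorem X_pow_dvd_sub_ofList_coeffList (n : ℕ) (p : R[X]) :
    X ^ n ∣ p - ofList (coeffList n p) := by
  rw [X_pow_dvd_iff]
  intro i hi
  rw [coeff_sub, coeff_ofList_coeffList p hi, sub_self]

theorem coeffList_congr {n : ℕ} {p q : R[X]} (h : ∀ i < n, p.coeff i = q.coeff i) :
    coeffList n p = coeffList n q :=
  List.map_congr_left fun i hi => h i (List.mem_range.1 hi)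

theorem fitList_length_append (l l' : List R) : fitList l.length (l ++ l') = l := by
  induction l with
  | nil => rfl
  | cons a l ih => simp [fitList, ih]

/-- A Newton step for the inverse of a power series. -/
theorem newton_step {q y : R[X]} {h c ℓ : ℕ} (hy : X ^ h ∣ q * y - 1) (hc : c ≤ 2 * h)
    (hl : c ≤ ℓ) : X ^ c ∣ q * ofList (coeffList ℓ (y * (2 - q * y))) - 1 := by
  have h₁ : X ^ c ∣ q * (y * (2 - q * y)) - 1 := by
    have : q * (y * (2 - q * y)) - 1 = -((q * y - 1) * (q * y - 1)) := by ring
    rw [this, dvd_neg]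
    refine (pow_dvd_pow X hc).trans ?_
    rw [two_mul, pow_add]
    exact mul_dvd_mul hy hy
  have h₂ := (pow_dvd_pow (X : R[X]) hl).trans
    (X_pow_dvd_sub_ofList_coeffList ℓ (y * (2 - q * y)))
  have h₃ := dvd_sub h₁ (h₂.mul_left q)
  convert h₃ using 1
  ring

/-- The leading coefficients of `X ^ n * g / ∏ (X - s)`, where `n` is the number of the `s`. -/
noncomputable def quotList (g : R[X]) (S : List R) : List R :=
  coeffList S.length ((X ^ S.length * g) /ₘ rootsPoly S)

theorem length_quotList (g : R[X]) (S : List R) : (quotList g S).length = S.length :=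
  length_coeffList _ _

/-- If `g = (X - s) * h + g(s)`, then `X * g = (X - s) * (X * h + g(s)) + s * g(s)`, so the constant
coefficient of the quotient is `g(s)`. -/
theorem quotList_singleton (g : R[X]) (s : R) : quotList g [s] = [g.eval s] := by
  rcases subsingleton_or_nontrivial R with _ | _
  · exact List.ext_getElem (by simp [length_quotList]) fun _ _ _ => Subsingleton.elim _ _
  have h : rootsPoly [s] = X - C s := by simp [rootsPoly]
  have h₁ : (X ^ 1 * g) /ₘ (X - C s) = X * (g /ₘ (X - C s)) + C (g.eval s) := by
    refine (div_modByMonic_unique (X * (g /ₘ (X - C s)) + C (g.eval s)) (C (s * g.eval s))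
      (monic_X_sub_C s) ⟨?_, ?_⟩).1
    · have := modByMonic_add_div g (X - C s)
      rw [modByMonic_X_sub_C_eq_C_eval] at this
      rw [C_mul]
      linear_combination X * this
    · rw [degree_X_sub_C]
      exact degree_C_le.trans_lt (by norm_num)
  rw [quotList, h, List.length_singleton, h₁]
  simp [coeffList, List.range_succ]

/-- In powers of `1/X`, `quotList g U` lists the coefficients of `X^(-1), …, X^(-|U|)` in `g /
rootsPoly U`, and multiplication by `rootsPoly T` turns this series into `g / rootsPoly S`. The
proof compares the polynomial quotients `D` and `E`: multiplied by the monic `rootsPoly S`, the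
difference `rootsPoly T * D - X^|T| * E` becomes a combination of remainders of degree below `|S| +
|T|`, so the difference has degree below `|T|`. Truncating `D` at `|U|` coefficients does not affect
the positions `|T| + i` with `i < |S|`. -/
theorem quotList_of_append (g : R[X]) (S T : List R) {U : List R}
    (hU : rootsPoly U = rootsPoly S * rootsPoly T) (hl : U.length = S.length + T.length) :
    fitList S.length ((mulList (rootsList T) (quotList g U)).drop T.length) = quotList g S := by
  rcases subsingleton_or_nontrivial R with _ | _
  · refine List.ext_getElem ?_ fun _ _ _ => Subsingleton.elim _ _
    rw [fitList_eq, length_coeffList, length_quotList]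
  rw [fitList_eq, quotList.eq_1 g S]
  apply coeffList_congr
  intro i hi
  have h₁ : (ofList ((mulList (rootsList T) (quotList g U)).drop T.length)).coeff i =
      (rootsPoly T * ofList (quotList g U)).coeff (T.length + i) := by
    rw [← ofList_rootsList, ← ofList_mulList, coeff_ofList, coeff_ofList,
      List.getD_eq_getElem?_getD,
      List.getD_eq_getElem?_getD, List.getElem?_drop]
  rw [h₁]
  set D := (X ^ U.length * g) /ₘ rootsPoly U with hD
  set E := (X ^ S.length * g) /ₘ rootsPoly S with hE
  have h₂ : (rootsPoly T * ofList (quotList g U)).coeff (T.length + i) =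
      (rootsPoly T * D).coeff (T.length + i) := by
    have := (X_pow_dvd_sub_ofList_coeffList U.length D).mul_left (rootsPoly T)
    rw [X_pow_dvd_iff] at this
    have := this (T.length + i) (by omega)
    rw [mul_sub, coeff_sub, sub_eq_zero] at this
    exact this.symm
  have h₃ : (rootsPoly T * D - X ^ T.length * E).degree < (T.length : WithBot ℕ) := by
    have e₁ := modByMonic_add_div (X ^ U.length * g) (rootsPoly U)
    have e₂ := modByMonic_add_div (X ^ S.length * g) (rootsPoly S)
    have d₁ := degree_modByMonic_lt (X ^ U.length * g) (monic_rootsPoly U)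
    have d₂ := degree_modByMonic_lt (X ^ S.length * g) (monic_rootsPoly S)
    rw [degree_eq_natDegree (monic_rootsPoly _).ne_zero, natDegree_rootsPoly] at d₁ d₂
    rw [← hD] at e₁
    rw [← hE] at e₂
    set M₁ := (X ^ U.length * g) %ₘ rootsPoly U
    set M₂ := (X ^ S.length * g) %ₘ rootsPoly S
    have e₃ : rootsPoly S * (rootsPoly T * D - X ^ T.length * E) = X ^ T.length * M₂ - M₁ := by
      rw [hU, hl, pow_add] at e₁
      linear_combination e₁ - X ^ T.length * e₂
    have d₃ : (X ^ T.length * M₂ - M₁).degree < ((S.length + T.length : ℕ) : WithBot ℕ) := by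
      rw [degree_lt_iff_coeff_zero] at d₁ d₂ ⊢
      intro k hk
      rw [coeff_sub, d₁ k (by omega), sub_zero, coeff_X_pow_mul', d₂ (k - T.length) (by omega),
        ite_self]
    rw [← e₃] at d₃
    by_contra hlt
    have h₀ : rootsPoly T * D - X ^ T.length * E ≠ 0 := by
      intro h; rw [h, degree_zero] at hlt; exact hlt (WithBot.bot_lt_coe _)
    rw [(monic_rootsPoly S).degree_mul_comm, (monic_rootsPoly S).degree_mul,
      degree_eq_natDegree (monic_rootsPoly _).ne_zero, natDegree_rootsPoly,
      degree_eq_natDegree h₀] at d₃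
    rw [degree_eq_natDegree h₀, Nat.cast_lt] at hlt
    have : (rootsPoly T * D - X ^ T.length * E).natDegree + S.length < S.length + T.length := by
      exact_mod_cast d₃
    omega
  have h₄ := (degree_lt_iff_coeff_zero _ _).1 h₃ (T.length + i) (by omega)
  rw [coeff_sub, sub_eq_zero, add_comm T.length i, coeff_X_pow_mul, add_comm i] at h₄
  rw [h₂, h₄]

theorem ofList_reverse {d : ℕ} {l : List R} (hl : l.length = d + 1) :
    ofList l.reverse = reflect d (ofList l) := by
  ext i
  rw [coeff_reflect, coeff_ofList, coeff_ofList]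
  rcases le_or_gt i d with h | h
  · rw [revAt_le h, List.getD_eq_getElem _ _ (by simp; omega), List.getD_eq_getElem _ _ (by omega),
      List.getElem_reverse]
    congr 1
    omega
  · rw [revAt_eq_self_of_lt h, List.getD_eq_default _ _ (by simp; omega),
      List.getD_eq_default _ _ (by omega)]

theorem natDegree_ofList_le {d : ℕ} {l : List R} (hl : l.length ≤ d + 1) :
    (ofList l).natDegree ≤ d := by
  rw [natDegree_le_iff_coeff_eq_zero]
  intro i hi
  rw [coeff_ofList, List.getD_eq_default _ _ (by omega)]

/-- Reversing coefficients turns polynomial division into power series division: the quotient of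
`X^d * g` by the monic `rootsPoly S` has degree at most `d`, and its reversal is `rev g / rev
(rootsPoly S)` modulo `X^(d + 1)`. -/
theorem reverse_tail_eq_quotList (g S : List R) (hg : g.length = S.length + 1) (y : List R)
    (hy : X ^ (S.length + 1) ∣ ofList (rootsList S).reverse * ofList y - 1) :
    (fitList (S.length + 1) (mulList g.reverse y)).tail.reverse = quotList (ofList g) S := by
  rcases subsingleton_or_nontrivial R with _ | _
  · refine List.ext_getElem ?_ fun _ _ _ => Subsingleton.elim _ _
    simp [fitList_eq, length_coeffList, length_quotList]
  set d := S.length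
  set z := fitList (d + 1) (mulList g.reverse y) with hz
  have hzl : z.length = d + 1 := by rw [hz, fitList_eq, length_coeffList]
  have h₁ : X ^ (d + 1) ∣ reflect d (rootsPoly S) * ofList z - reflect d (ofList g) := by
    rw [ofList_reverse (d := d) (length_rootsList S), ofList_rootsList] at hy
    rw [hz, fitList_eq, ofList_mulList, ← ofList_reverse hg]
    have h₂ := (X_pow_dvd_sub_ofList_coeffList (d + 1) (ofList g.reverse * ofList y)).mul_left
      (reflect d (rootsPoly S))
    have h₃ := dvd_sub (hy.mul_left (ofList g.reverse)) h₂
    convert h₃ using 1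
    ring
  have hQd : (rootsPoly S).natDegree ≤ d := (natDegree_rootsPoly S).le
  have hgd : (ofList g).natDegree ≤ d := natDegree_ofList_le hg.le
  have hzd : (ofList z).natDegree ≤ d := natDegree_ofList_le hzl.le
  have h₄ : rootsPoly S * reflect d (ofList z) =
      reflect (d + d) (reflect d (rootsPoly S) * ofList z) := by
    rw [reflect_mul _ _ (natDegree_reflect_le.trans (max_le le_rfl hQd)) hzd, reflect_reflect]
  have h₅ : (X ^ d * ofList g) /ₘ rootsPoly S = reflect d (ofList z) := by
    refine (div_modByMonic_unique (reflect d (ofList z))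
      (X ^ d * ofList g - rootsPoly S * reflect d (ofList z)) (monic_rootsPoly S)
      ⟨by ring, ?_⟩).1
    rw [degree_eq_natDegree (monic_rootsPoly _).ne_zero, natDegree_rootsPoly,
      degree_lt_iff_coeff_zero]
    intro i hi
    change d ≤ i at hi
    rw [coeff_sub, sub_eq_zero, coeff_X_pow_mul', if_pos hi, h₄, coeff_reflect]
    rcases le_or_gt i (d + d) with h | h
    · rw [revAt_le h]
      have := (X_pow_dvd_iff.1 h₁) (d + d - i) (by omega)
      rw [coeff_sub, sub_eq_zero] at this
      rw [this, coeff_reflect, revAt_le (by omega)]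
      congr 1
      omega
    · rw [revAt_eq_self_of_lt h, coeff_eq_zero_of_natDegree_lt (by omega),
        coeff_eq_zero_of_natDegree_lt]
      refine lt_of_le_of_lt ((natDegree_mul_le).trans (add_le_add ?_ hzd)) h
      exact natDegree_reflect_le.trans (max_le le_rfl hQd)
  -- The head of `z` is the coefficient of `X^d` in the quotient, just outside the `d` coefficients
  -- that `quotList` keeps.
  obtain ⟨a, z', hz'⟩ := List.exists_cons_of_length_eq_add_one hzl
  have hl' : z'.reverse.length = d := by
    rw [List.length_reverse]; rw [hz', List.length_cons] at hzl; omega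
  have h₆ := fitList_length_append z'.reverse [a]
  rw [quotList, h₅, ← ofList_reverse hzl, ← fitList_eq, hz', List.reverse_cons, List.tail_cons]
  rw [hl'] at h₆
  exact h₆.symm

end Polynomials

/-! ### Costs of the product tree, of Newton inversion and of multipoint evaluation. -/

section

variable {N : ℕ}

theorem BlockSizes.le {ms : List ℕ} {L A : ℕ} (h : BlockSizes ms L A) : 200 ≤ A := by
  cases h <;> nlinarith

theorem fitList_mulList_rootsList {R : Type*} [CommRing R] {S T U : List R}
    (hU : rootsPoly U = rootsPoly S * rootsPoly T) :
    fitList (U.length + 1) (mulList (rootsList S) (rootsList T)) = rootsList U := by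
  rw [fitList_eq, ofList_mulList, ofList_rootsList, ofList_rootsList, ← hU, rootsList]

theorem rootsPoly_take_mul_drop {R : Type*} [CommRing R] (n : ℕ) (S : List R) :
    rootsPoly S = rootsPoly (S.take n) * rootsPoly (S.drop n) := by
  rw [← rootsPoly_append, List.take_append_drop]

theorem rootsList_singleton {R : Type*} [CommRing R] (s : R) : rootsList [s] = [0 - s, 1] := by
  simp [rootsList, rootsPoly, coeffList, List.range_succ, coeff_X, coeff_C]

/-- The two halves together use `4 * A * (n * (D + 1))` for `n = S.length`; the additional `4 * A *
n` of one level pays for the multiplication and the list operations. -/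
theorem rootsPoly_spec {ms : List ℕ} {L A : ℕ} (hB : BlockSizes ms L A) {D : ℕ}
    {S : List (ZMod N)} (h₀ : S ≠ []) (hD : S.length ≤ 2 ^ D) (hL : S.length + 2 ≤ L) :
    Call Prog.table 17 (.cons (sizesVal N ms) (polyVal S)) (polyVal (rootsList S))
      (4 * A * (S.length * (D + 1))) := by
  have hA := hB.le
  induction D generalizing S with
  | zero =>
    obtain ⟨s, rfl⟩ := List.length_eq_one_iff.1
      (le_antisymm (by simpa using hD) (List.length_pos_iff.2 h₀))
    refine Call.of_wp (body := Prog.rootsPoly) rfl ?_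
    simp only [wp, wpVar, wpCase, wpNum, Prog.rootsPoly, polyVal_cons, polyVal_nil,
      rootsList_singleton, Nat.cast_zero, Nat.cast_one]
    refine ⟨trivial, ?_⟩
    simp only [List.length_singleton]; omega
  | succ D ih =>
    match S, h₀ with
    | [s], _ =>
      refine Call.of_wp (body := Prog.rootsPoly) rfl ?_
      simp only [wp, wpVar, wpCase, wpNum, Prog.rootsPoly, polyVal_cons, polyVal_nil,
        rootsList_singleton, Nat.cast_zero, Nat.cast_one]
      refine ⟨trivial, ?_⟩
      simp only [List.length_singleton]; nlinarith
    | s :: s' :: S', _ =>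
      set S := s :: s' :: S' with hS
      have hn : 2 ≤ S.length := by simp [hS]
      have hev := evens_spec (S.map Val.num)
      have hlen := length_evensList (S.map (Val.num : ZMod N → Val N))
      set h := evensList (S.map (Val.num : ZMod N → Val N))
      rw [List.length_map] at hev hlen
      have hta := take_polyVal_spec h S
      have hdr := drop_polyVal_spec h S
      have hfit := fit_spec (Val.nil :: S.map Val.num)
        (mulList (rootsList (S.take h.length)) (rootsList (S.drop h.length)))
      rw [List.length_cons, List.length_map,
        fitList_mulList_rootsList (rootsPoly_take_mul_drop _ _)] at hfit
      have l₁ : (S.take h.length).length = h.length := by rw [List.length_take]; omega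
      have l₂ : (S.drop h.length).length = S.length - h.length := List.length_drop
      rw [pow_succ] at hD
      have i₁ := ih (S := S.take h.length) (by rw [← List.length_pos_iff]; omega) (by omega)
        (by omega)
      have i₂ := ih (S := S.drop h.length) (by rw [← List.length_pos_iff]; omega) (by omega)
        (by omega)
      have hmul := mul_spec hB (rootsList (S.take h.length)) (rootsList (S.drop h.length))
        (by rw [length_rootsList, length_rootsList]; omega)
      rw [length_rootsList, length_rootsList] at hmul
      rw [l₁] at i₁ hmul
      rw [l₂] at i₂ hmul
      refine Call.of_wp (body := Prog.rootsPoly) rfl ?_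
      have hc : polyVal S = .cons (.num s) (.cons (.num s') (polyVal S')) := rfl
      simp only [wp, wpVar, wpCase, Prog.rootsPoly, hc]
      rw [← hc]
      refine WpCall.intro hev ?_
      refine WpCall.intro hta ?_
      refine WpCall.intro hdr ?_
      refine WpCall.intro i₁ ?_
      refine WpCall.intro i₂ ?_
      refine WpCall.intro hmul ?_
      refine WpCall.intro hfit ⟨rfl, ?_⟩
      have e₁ : 4 * A * (h.length * (D + 1)) + 4 * A * ((S.length - h.length) * (D + 1)) =
          4 * A * (S.length * (D + 1)) := by
        rw [← mul_add, ← add_mul, Nat.add_sub_cancel' (by omega)]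
      have e₂ : A * (h.length + 1 + (S.length - h.length + 1) + 1) = A * S.length + 3 * A := by
        rw [show h.length + 1 + (S.length - h.length + 1) + 1 = S.length + 3 by omega]; ring
      have e₃ : 4 * A * (S.length * (D + 1 + 1)) =
        4 * A * (S.length * (D + 1)) + 4 * (A * S.length) := by ring
      have e₄ : 200 * S.length ≤ A * S.length := Nat.mul_le_mul_right _ hA
      have e₅ : A * 2 ≤ A * S.length := Nat.mul_le_mul_left _ hn
      rw [e₂, e₃]
      omega

/-- The inverse is only controlled modulo `X^c.length`: each Newton step works at the full length of
`q`, and the coefficients beyond the current precision are arbitrary. Hence the existential `y` and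
a cost proportional to `q.length` at each of the `D + 1` levels. -/
theorem inverse_spec {ms : List ℕ} {L A : ℕ} (hB : BlockSizes ms L A) {q : List (ZMod N)}
    (hq : (ofList q).coeff 0 = 1) (hL : 3 * q.length ≤ L) {D : ℕ} {c : List (Val N)}
    (hc : c.length ≤ q.length) (h₀ : q ≠ []) (hD : c.length ≤ 2 ^ D) :
    ∃ y : List (ZMod N), y.length ≤ q.length ∧ X ^ c.length ∣ ofList q * ofList y - 1 ∧
      Call Prog.table 18 (.cons (sizesVal N ms) (.cons (polyVal q) (listVal c))) (polyVal y)
        (10 * A * (q.length * (D + 1))) := by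
  have hA := hB.le
  have hl : 1 ≤ q.length := List.length_pos_iff.2 h₀
  have hone : X ^ 1 ∣ ofList q * ofList [1] - 1 := by
    rw [X_pow_dvd_iff]
    intro i hi
    obtain rfl : i = 0 := by omega
    simp [ofList, hq]
  have hcost : 200 * 1 ≤ A * (q.length * (D + 1)) := by
    have : 1 ≤ q.length * (D + 1) := by nlinarith
    exact Nat.mul_le_mul hA this
  induction D generalizing c with
  | zero =>
    refine ⟨[1], hl, (pow_dvd_pow X (by simpa using hD)).trans hone, ?_⟩
    refine Call.of_wp (body := Prog.inverse) rfl ?_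
    rw [mul_assoc]
    match c, hD with
    | [], _ =>
      simp only [wp, wpVar, wpCase, Prog.inverse, listVal_nil, Nat.cast_one]
      exact ⟨rfl, by omega⟩
    | [x], _ =>
      simp only [wp, wpVar, wpCase, Prog.inverse, listVal_nil, listVal_cons, Nat.cast_one]
      exact ⟨rfl, by omega⟩
  | succ D ih =>
    match c, hD with
    | [], _ =>
      refine ⟨[1], hl, (pow_dvd_pow X (by simp)).trans hone, ?_⟩
      refine Call.of_wp (body := Prog.inverse) rfl ?_
      rw [mul_assoc]
      simp only [wp, wpVar, wpCase, Prog.inverse, listVal_nil, Nat.cast_one]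
      exact ⟨rfl, by omega⟩
    | [x], _ =>
      refine ⟨[1], hl, (pow_dvd_pow X (by simp)).trans hone, ?_⟩
      refine Call.of_wp (body := Prog.inverse) rfl ?_
      rw [mul_assoc]
      simp only [wp, wpVar, wpCase, Prog.inverse, listVal_nil, listVal_cons, Nat.cast_one]
      exact ⟨rfl, by omega⟩
    | x :: x' :: c', hD =>
      set c := x :: x' :: c' with hc'
      have hev := evens_spec c
      have hlen := length_evensList c
      rw [pow_succ] at hD
      obtain ⟨y, hyl, hy, hcall⟩ := ih (c := evensList c) (by omega) (by omega) (by
        have : 1 ≤ q.length * (D + 1) := by nlinarith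
        exact Nat.mul_le_mul hA this)
      have m₁ := mul_spec hB q y (by omega)
      have hax := axpy_spec (-1) (mulList q y) [2]
      have m₂ := mul_spec hB y (axpyList (-1) (mulList q y) [2])
        (by rw [length_axpyList, length_mulList, List.length_singleton]; omega)
      have hfit := fit_spec (q.map Val.num) (mulList y (axpyList (-1) (mulList q y) [2]))
      have hpoly : ofList (axpyList (-1) (mulList q y) [2]) = 2 - ofList q * ofList y := by
        rw [ofList_axpyList, ofList_mulList]
        simp only [ofList, C_neg, C_1, mul_zero, add_zero]
        rw [show (C (2 : ZMod N)) = 2 from rfl]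
        ring
      rw [List.length_map, fitList_eq, ofList_mulList, hpoly] at hfit
      refine ⟨_, (length_coeffList q.length _).le, newton_step hy (by omega) hc, ?_⟩
      refine Call.of_wp (body := Prog.inverse) rfl ?_
      simp only [wp, wpVar, wpCase, wpNum, Prog.inverse, hc', listVal_cons, Nat.cast_zero,
        Nat.cast_one, zero_sub, Nat.cast_ofNat]
      refine WpCall.intro hev ?_
      refine WpCall.intro hcall ?_
      refine WpCall.intro m₁ ?_
      refine WpCall.intro hax ?_
      refine WpCall.intro m₂ ?_
      refine WpCall.intro hfit ⟨rfl, ?_⟩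
      rw [length_axpyList, length_mulList, List.length_singleton]
      have e₁ : A * (q.length + y.length + 1) ≤ A * (3 * q.length) :=
        Nat.mul_le_mul_left _ (by omega)
      have e₂ : A * (y.length + max (q.length + y.length) 1 + 1) ≤ A * (4 * q.length) :=
        Nat.mul_le_mul_left _ (by omega)
      have e₃ : 10 * A * (q.length * (D + 1 + 1)) =
        10 * A * (q.length * (D + 1)) + 10 * (A * q.length) := by ring
      have e₄ : 200 * q.length ≤ A * q.length := Nat.mul_le_mul_right _ hA
      rw [e₃]
      rw [show A * (3 * q.length) = 3 * (A * q.length) by ring] at e₁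
      rw [show A * (4 * q.length) = 4 * (A * q.length) by ring] at e₂
      omega

/-- The second factor `D + 1` arises because the subproducts are not stored: every level of the tree
recomputes them with `rootsPoly_spec`. -/
theorem evalTree_spec {ms : List ℕ} {L A : ℕ} (hB : BlockSizes ms L A) (g : (ZMod N)[X]) {D : ℕ}
    {S : List (ZMod N)} (h₀ : S ≠ []) (hD : S.length ≤ 2 ^ D) (hL : 2 * S.length + 2 ≤ L) :
    Call Prog.table 20 (.cons (sizesVal N ms) (.cons (polyVal S) (polyVal (quotList g S))))
      (polyVal (S.map g.eval)) (10 * A * (S.length * ((D + 1) * (D + 1)))) := by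
  have hA := hB.le
  induction D generalizing S with
  | zero =>
    obtain ⟨s, rfl⟩ := List.length_eq_one_iff.1
      (le_antisymm (by simpa using hD) (List.length_pos_iff.2 h₀))
    refine Call.of_wp (body := Prog.evalTree) rfl ?_
    simp only [wp, wpVar, wpCase, Prog.evalTree, polyVal_cons, polyVal_nil, quotList_singleton,
      List.map_cons, List.map_nil]
    refine ⟨trivial, ?_⟩
    simp only [List.length_singleton]; omega
  | succ D ih =>
    match S, h₀ with
    | [s], _ =>
      refine Call.of_wp (body := Prog.evalTree) rfl ?_
      simp only [wp, wpVar, wpCase, Prog.evalTree, polyVal_cons, polyVal_nil, quotList_singleton,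
        List.map_cons, List.map_nil]
      refine ⟨trivial, ?_⟩
      simp only [List.length_singleton]; nlinarith
    | s :: s' :: S', _ =>
      set S := s :: s' :: S' with hS
      have hn : 2 ≤ S.length := by simp [hS]
      rw [pow_succ] at hD
      -- Both halves are handled alike: the data for `T` come from multiplication by the polynomial
      -- with the roots `U`.
      have branch : ∀ T U : List (ZMod N), T ≠ [] → U ≠ [] → T.length ≤ 2 ^ D → U.length ≤ 2 ^ D →
          T.length + U.length = S.length → rootsPoly S = rootsPoly T * rootsPoly U →
          Call Prog.table 21 (.cons (sizesVal N ms) (.cons (polyVal T) (.cons (polyVal U)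
            (polyVal (quotList g S))))) (polyVal (T.map g.eval))
            (10 * A * (T.length * ((D + 1) * (D + 1))) + 4 * A * (U.length * (D + 1)) +
              A * (U.length + S.length + 2) + 50 * S.length + 100) := by
        intro T U hT hU hTD hUD hl hp
        have r₁ := rootsPoly_spec hB hU hUD (by omega)
        have r₂ := mul_spec hB (rootsList U) (quotList g S)
          (by rw [length_rootsList, length_quotList]; omega)
        have r₃ := drop_polyVal_spec (U.map Val.num) (mulList (rootsList U) (quotList g S))
        have r₄ := fit_spec (T.map Val.num) ((mulList (rootsList U) (quotList g S)).drop U.length)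
        rw [List.length_map] at r₃ r₄
        rw [quotList_of_append g T U hp hl.symm] at r₄
        rw [length_rootsList, length_quotList] at r₂
        refine Call.of_wp (body := Prog.evalBranch) rfl ?_
        simp only [wp, wpVar, wpCase, Prog.evalBranch]
        refine WpCall.intro r₁ ?_
        refine WpCall.intro r₂ ?_
        refine WpCall.intro r₃ ?_
        refine WpCall.intro r₄ ?_
        refine WpCall.intro (ih hT hTD (by omega)) ⟨rfl, ?_⟩
        rw [show U.length + S.length + 2 = U.length + 1 + S.length + 1 by omega]
        omega
      have hev := evens_spec (S.map Val.num)
      have hlen := length_evensList (S.map (Val.num : ZMod N → Val N))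
      set h := evensList (S.map (Val.num : ZMod N → Val N))
      rw [List.length_map] at hev hlen
      have hta := take_polyVal_spec h S
      have hdr := drop_polyVal_spec h S
      have l₁ : (S.take h.length).length = h.length := by rw [List.length_take]; omega
      have l₂ : (S.drop h.length).length = S.length - h.length := List.length_drop
      have n₁ : S.take h.length ≠ [] := by rw [← List.length_pos_iff]; omega
      have n₂ : S.drop h.length ≠ [] := by rw [← List.length_pos_iff]; omega
      have hp := rootsPoly_take_mul_drop h.length S
      have b₁ := branch (S.take h.length) (S.drop h.length) n₁ n₂ (by omega) (by omega) (by omega)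
        hp
      have b₂ := branch (S.drop h.length) (S.take h.length) n₂ n₁ (by omega) (by omega) (by omega)
        (hp.trans (mul_comm _ _))
      have happ := append_polyVal_spec ((S.take h.length).map g.eval) ((S.drop h.length).map g.eval)
      rw [← List.map_append, List.take_append_drop, List.length_map, l₁] at happ
      rw [l₁, l₂] at b₁ b₂
      refine Call.of_wp (body := Prog.evalTree) rfl ?_
      have hc : polyVal S = .cons (.num s) (.cons (.num s') (polyVal S')) := rfl
      simp only [wp, wpVar, wpCase, Prog.evalTree, hc]
      rw [← hc]
      refine WpCall.intro hev ?_
      refine WpCall.intro hta ?_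
      refine WpCall.intro hdr ?_
      refine WpCall.intro b₁ ?_
      refine WpCall.intro b₂ ?_
      refine WpCall.intro happ ⟨rfl, ?_⟩
      obtain ⟨k, hk⟩ := Nat.exists_eq_add_of_le (show h.length ≤ S.length by omega)
      have hk' : S.length - h.length = k := by omega
      rw [hk']
      have e₁ : 10 * A * (h.length * ((D + 1) * (D + 1))) + 4 * A * (k * (D + 1)) +
          A * (k + S.length + 2) + (10 * A * (k * ((D + 1) * (D + 1))) +
          4 * A * (h.length * (D + 1)) + A * (h.length + S.length + 2)) =
          10 * A * (S.length * ((D + 1) * (D + 1))) + 4 * (A * (S.length * (D + 1))) +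
          3 * (A * S.length) + 4 * A := by rw [hk]; ring
      have e₂ : 10 * A * (S.length * ((D + 1 + 1) * (D + 1 + 1))) =
        10 * A * (S.length * ((D + 1) * (D + 1))) + 20 * (A * (S.length * (D + 1))) +
          10 * (A * S.length) := by ring
      have e₄ : 200 * S.length ≤ A * S.length := Nat.mul_le_mul_right _ hA
      have e₅ : A * 2 ≤ A * S.length := Nat.mul_le_mul_left _ hn
      rw [e₂]
      omega

theorem values_spec {ms : List ℕ} {L A : ℕ} (hB : BlockSizes ms L A) {D : ℕ}
    {g S : List (ZMod N)} (h₀ : S ≠ []) (hg : g.length = S.length + 1)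
    (hD : S.length + 1 ≤ 2 ^ D) (hL : 3 * (S.length + 1) ≤ L) :
    Call Prog.table 22 (.cons (sizesVal N ms) (.cons (polyVal g) (polyVal S)))
      (polyVal (S.map (ofList g).eval))
      (40 * (A * ((S.length + 1) * ((D + 1) * (D + 1))))) := by
  have hA := hB.le
  have r₁ := rootsPoly_spec hB h₀ (D := D) (by omega) (by omega)
  have r₂ := reverse_spec (rootsList S) []
  have r₄ := reverse_spec g []
  rw [List.append_nil] at r₂ r₄
  rw [length_rootsList] at r₂
  -- The reversal of a monic polynomial has constant term `1`, so it is invertible as a power series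
  -- for every modulus.
  have hcoeff : (ofList (rootsList S).reverse).coeff 0 = 1 := by
    rw [ofList_reverse (length_rootsList S), ofList_rootsList, coeff_reflect, revAt_zero]
    rcases subsingleton_or_nontrivial (ZMod N) with hs | hs
    · exact Subsingleton.elim _ _
    have := (monic_rootsPoly S).coeff_natDegree
    rwa [natDegree_rootsPoly] at this
  have hlen : (rootsList S).reverse.length = S.length + 1 := by
    rw [List.length_reverse, length_rootsList]
  have hne : (rootsList S).reverse ≠ [] := by rw [← List.length_pos_iff]; omega
  obtain ⟨y, hyl, hy, r₃⟩ := inverse_spec hB hcoeff (by omega) (D := D)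
    (c := (rootsList S).reverse.map Val.num) (by rw [List.length_map]) hne
    (by rw [List.length_map]; omega)
  rw [List.length_map, hlen] at hy
  rw [hlen] at r₃ hyl
  have r₅ := mul_spec hB g.reverse y (by rw [List.length_reverse]; omega)
  have r₆ := fit_spec ((rootsList S).reverse.map Val.num) (mulList g.reverse y)
  rw [List.length_map, hlen] at r₆
  have hquot := reverse_tail_eq_quotList g S hg y hy
  set z := fitList (S.length + 1) (mulList g.reverse y) with hz
  have hzl : z.length = S.length + 1 := by rw [hz, fitList_eq, length_coeffList]
  obtain ⟨a, z', hz'⟩ := List.exists_cons_of_length_eq_add_one hzl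
  have hzl' : z'.length = S.length := by rw [hz', List.length_cons] at hzl; omega
  have r₇ := reverse_spec z' []
  rw [hz', List.tail_cons] at hquot
  rw [List.append_nil, hquot, hzl'] at r₇
  have r₈ := evalTree_spec hB (ofList g) h₀ (D := D) (by omega) (by omega)
  refine Call.of_wp (body := Prog.values) rfl ?_
  simp only [wp, wpVar, wpCase, Prog.values]
  refine WpCall.intro r₁ ?_
  refine WpCall.intro r₂ ?_
  refine WpCall.intro r₃ ?_
  refine WpCall.intro r₄ ?_
  refine WpCall.intro r₅ ?_
  refine WpCall.intro r₆ ?_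
  rw [hz', polyVal_cons]
  simp only
  refine WpCall.intro r₇ ?_
  refine WpCall.intro r₈ ⟨rfl, ?_⟩
  have e₀ : D + 1 ≤ (D + 1) * (D + 1) := Nat.le_mul_of_pos_right _ (by omega)
  have e₁ : A * (S.length * (D + 1)) ≤ A * ((S.length + 1) * ((D + 1) * (D + 1))) :=
    Nat.mul_le_mul_left _ (Nat.mul_le_mul (by omega) e₀)
  have e₂ : A * ((S.length + 1) * (D + 1)) ≤ A * ((S.length + 1) * ((D + 1) * (D + 1))) :=
    Nat.mul_le_mul_left _ (Nat.mul_le_mul_left _ e₀)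
  have e₃ : A * (S.length * ((D + 1) * (D + 1))) ≤ A * ((S.length + 1) * ((D + 1) * (D + 1))) :=
    Nat.mul_le_mul_left _ (Nat.mul_le_mul_right _ (by omega))
  have e₄ : A * (S.length + 1) ≤ A * ((S.length + 1) * ((D + 1) * (D + 1))) :=
    Nat.mul_le_mul_left _ (Nat.le_mul_of_pos_right _ (by positivity))
  have e₅ : 200 * (S.length + 1) ≤ A * (S.length + 1) := Nat.mul_le_mul_right _ hA
  have e₆ : A * (g.reverse.length + y.length + 1) ≤ 3 * (A * (S.length + 1)) := by
    rw [List.length_reverse, ← mul_left_comm]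
    exact Nat.mul_le_mul_left _ (by omega)
  rw [mul_assoc 4, mul_assoc 10, mul_assoc 10]
  omega

end

/-! ### The search for a factor -/

section

variable {N : ℕ}

/-- The program compares gcds only as residues. For divisors of `N` the tests against `1` and `0`
are faithful, also for `N = 1`, where `0` and `1` coincide but the only divisor is `1`. -/
theorem cast_eq_one_iff_of_dvd [NeZero N] {H : ℕ} (h : H ∣ N) :
    (H : ZMod N) = ((1 : ℕ) : ZMod N) ↔ H = 1 := by
  refine ⟨fun e => ?_, fun e => by rw [e]⟩
  have hN : 0 < N := Nat.pos_of_neZero N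
  rw [ZMod.natCast_eq_natCast_iff'] at e
  rcases (Nat.le_of_dvd hN h).eq_or_lt with rfl | hlt
  · rw [Nat.mod_self] at e
    exact Nat.dvd_one.1 (Nat.dvd_of_mod_eq_zero e.symm)
  · have : H ≠ 0 := fun h₀ => by rw [h₀, zero_dvd_iff] at h; omega
    rwa [Nat.mod_eq_of_lt hlt, Nat.mod_eq_of_lt (by omega)] at e

theorem cast_eq_zero_iff_of_dvd {H : ℕ} (h : H ∣ N) :
    (H : ZMod N) = ((0 : ℕ) : ZMod N) ↔ H = N := by
  rw [Nat.cast_zero, ZMod.natCast_eq_zero_iff]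
  exact ⟨fun e => Nat.dvd_antisymm h e, fun e => e ▸ dvd_rfl⟩

theorem gcd_val_intCast [NeZero N] (a : ℤ) : Nat.gcd (a : ZMod N).val N = Int.gcd a N := by
  have h : (((a : ZMod N).val : ℕ) : ℤ) = a % N := ZMod.val_intCast a
  rw [← Int.gcd_natCast_natCast, h, Int.gcd_emod]

theorem eval_linearPolys {d : ℕ} (b : Fin d → ℕ) (n : Fin d) (x : ℤ) :
    (linearPolys b n).eval x = x - b n := by
  simp [linearPolys]

theorem drop_ofFn {α : Type*} {d : ℕ} (u : Fin d → α) {i : ℕ} (hi : i < d) :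
    (List.ofFn u).drop i = u ⟨i, hi⟩ :: (List.ofFn u).drop (i + 1) := by
  rw [List.drop_eq_getElem_cons (by simpa using hi)]
  simp

theorem searchBase_spec [NeZero N] {d : ℕ} (b : Fin d → ℕ) (x i : ℕ) (hi : i ≤ d) :
    Call Prog.table 23
      (.cons (.num (x : ZMod N)) (polyVal ((List.ofFn fun n => (b n : ZMod N)).drop i)))
      (encodeOutput N (step6 N (linearPolys b) (x : ℤ) i)) (40 * (d - i + 1)) := by
  induction hk : d - i generalizing i with
  | zero =>
    obtain rfl : i = d := by omega
    rw [List.drop_eq_nil_of_le (by simp), step6, dif_neg (lt_irrefl _)]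
    refine Call.of_wp (body := Prog.searchBase) rfl ?_
    simp only [wp, wpVar, wpCase, Prog.searchBase, polyVal_nil]
    exact ⟨rfl, by omega⟩
  | succ k ih =>
    have hlt : i < d := by omega
    have hcall := ih (i + 1) (by omega) (by omega)
    rw [drop_ofFn _ hlt, step6, dif_pos hlt]
    have hg : Nat.gcd ((x : ZMod N) - (b ⟨i, hlt⟩ : ZMod N)).val N =
        Int.gcd ((linearPolys b ⟨i, hlt⟩).eval (x : ℤ)) N := by
      rw [eval_linearPolys, ← gcd_val_intCast]; push_cast; rfl
    refine Call.of_wp (body := Prog.searchBase) rfl ?_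
    simp only [wp, wpVar, wpCase, wpNum, Prog.searchBase, polyVal_cons, hg]
    have hdvd : Int.gcd ((linearPolys b ⟨i, hlt⟩).eval (x : ℤ)) N ∣ N := by
      have := Int.gcd_dvd_right ((linearPolys b ⟨i, hlt⟩).eval (x : ℤ)) (N : ℤ)
      exact_mod_cast this
    simp only [ne_eq, cast_eq_one_iff_of_dvd hdvd, cast_eq_zero_iff_of_dvd hdvd]
    refine ⟨fun h₁ => ?_, fun h₁ => ⟨fun h₂ => ?_, fun h₂ => ?_⟩⟩
    · rw [if_pos (Or.inl h₁)]
      exact WpCall.intro hcall ⟨rfl, by omega⟩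
    · rw [if_pos (Or.inr h₂)]
      exact WpCall.intro hcall ⟨rfl, by omega⟩
    · rw [if_neg (by tauto)]
      exact ⟨rfl, by omega⟩

/-- The two summands add rather than multiply because Step 6 never returns to Step 4: the search
through the `b_i` happens at most once. -/
theorem searchPoint_spec [NeZero N] {d : ℕ} (b s : Fin d → ℕ) (j : ℕ) (hj : j ≤ d) :
    Call Prog.table 24
      (.cons (polyVal ((List.ofFn (yValue N (linearPolys b) s)).drop j))
        (.cons (polyVal ((List.ofFn fun n => (s n : ZMod N)).drop j))
          (polyVal (List.ofFn fun n => (b n : ZMod N)))))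
      (encodeOutput N (step4 N (linearPolys b) s j)) (40 * (d - j + 1) + 40 * (d + 1)) := by
  induction hk : d - j generalizing j with
  | zero =>
    obtain rfl : j = d := by omega
    rw [List.drop_eq_nil_of_le (by simp), List.drop_eq_nil_of_le (by simp), step4,
      dif_neg (lt_irrefl _)]
    refine Call.of_wp (body := Prog.searchPoint) rfl ?_
    simp only [wp, wpVar, wpCase, Prog.searchPoint, polyVal_nil]
    exact ⟨rfl, by omega⟩
  | succ k ih =>
    have hlt : j < d := by omega
    have hcall := ih (j + 1) (by omega) (by omega)
    have hbase := searchBase_spec (N := N) b (s ⟨j, hlt⟩) 0 (Nat.zero_le d)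
    rw [List.drop_zero] at hbase
    rw [drop_ofFn _ hlt, drop_ofFn _ hlt, step4, dif_pos hlt]
    refine Call.of_wp (body := Prog.searchPoint) rfl ?_
    simp only [wp, wpVar, wpCase, wpNum, Prog.searchPoint, polyVal_cons]
    have hdvd := Nat.gcd_dvd_right (yValue N (linearPolys b) s ⟨j, hlt⟩).val N
    simp only [ne_eq, cast_eq_one_iff_of_dvd hdvd, cast_eq_zero_iff_of_dvd hdvd]
    refine ⟨fun h₁ => ?_, fun h₁ => ⟨fun h₂ => ?_, fun h₂ => ?_⟩⟩
    · rw [if_pos h₁]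
      exact WpCall.intro hcall ⟨rfl, by omega⟩
    · rw [if_neg h₁, if_pos h₂]
      exact WpCall.intro hbase ⟨rfl, by omega⟩
    · rw [if_neg h₁, if_neg h₂]
      exact ⟨rfl, by omega⟩

/-! ### The choice of the block sizes -/

/-- The sequence of the block sizes. -/
def blockSize (i : ℕ) : ℕ := 2 ^ ((16 + i) * (16 + i))

/-- The quotients of consecutive block sizes. -/
def blockRatio (i : ℕ) : ℕ := 2 ^ (2 * i + 33)

theorem blockSize_succ (i : ℕ) : blockSize (i + 1) = blockRatio i * blockSize i := by
  rw [blockSize, blockSize, blockRatio, ← pow_add]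
  congr 1
  ring

theorem blockRatio_succ (i : ℕ) :
    blockRatio (i + 1) = blockRatio i + blockRatio i + (blockRatio i + blockRatio i) := by
  rw [blockRatio, blockRatio, show 2 * (i + 1) + 33 = 2 * i + 33 + 2 by ring, pow_add]
  ring

/-- The first block sizes in decreasing order. -/
def blockSizeList : ℕ → List ℕ
  | 0 => []
  | i + 1 => blockSize i :: blockSizeList i

/-- Since `32 > 20` and the overhead `P^2` grows only like `16^i`, a bound of the form `const *
32^i` survives each level. The factor `8` leaves room for the products of total length up to `3 * (d
+ 1)` needed in evaluation, and for the length `4 * m` of the recursive products. -/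
theorem blockSizes_blockSizeList (i : ℕ) :
    BlockSizes (blockSizeList i) (8 * blockSize i) (10 ^ 100 * 32 ^ i) := by
  induction i with
  | zero =>
    refine .nil ?_
    rw [blockSize]
    norm_num
  | succ i ih =>
    have hq : 2 ≤ blockRatio i := by
      rw [blockRatio, pow_add]
      have := Nat.one_le_two_pow (n := 2 * i)
      omega
    -- The total length `8 * blockSize (i + 1)` is `8 * blockRatio i` blocks of size `blockSize i`;
    -- doubling this leaves room for the two extra blocks.
    refine .cons (P := 16 * blockRatio i) (by rw [blockSize]; positivity) ?_ ?_
      (ih.mono (Nat.mul_le_mul_right _ (by norm_num)) le_rfl) ?_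
    · rw [blockSize, blockRatio]
      have : 16 * 2 ^ (2 * i + 33) * (16 * 2 ^ (2 * i + 33)) = 2 ^ (4 * i + 74) := by
        rw [show 4 * i + 74 = (2 * i + 33) + (2 * i + 33) + 8 by ring, pow_add, pow_add]
        ring
      rw [this]
      exact Nat.pow_le_pow_right (by norm_num) (by nlinarith)
    · rw [blockSize_succ]
      nlinarith [Nat.zero_le (blockSize i)]
    · have h₁ : (16 * blockRatio i + 1) * (16 * blockRatio i + 1) ≤
          17 * blockRatio i * (17 * blockRatio i) := Nat.mul_le_mul (by omega) (by omega)
      have h₂ : blockRatio i * blockRatio i = 2 ^ 66 * 16 ^ i := by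
        rw [blockRatio, show (16 : ℕ) = 2 ^ 4 by norm_num, ← pow_mul, ← pow_add, ← pow_add]
        congr 1
        ring
      have h₃ : (16 : ℕ) ^ i ≤ 32 ^ i := Nat.pow_le_pow_left (by norm_num) i
      calc 20 * (10 ^ 100 * 32 ^ i) +
            10000 * ((16 * blockRatio i + 1) * (16 * blockRatio i + 1))
          ≤ 20 * (10 ^ 100 * 32 ^ i) + 10000 * (289 * (2 ^ 66 * 32 ^ i)) := by
            refine Nat.add_le_add_left (Nat.mul_le_mul_left _ (h₁.trans ?_)) _
            calc 17 * blockRatio i * (17 * blockRatio i) = 289 * (2 ^ 66 * 16 ^ i) := by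
                  rw [← h₂]; ring
              _ ≤ 289 * (2 ^ 66 * 32 ^ i) := by gcongr
        _ = (20 * 10 ^ 100 + 2890000 * 2 ^ 66) * 32 ^ i := by ring
        _ ≤ (10 ^ 100 * 32) * 32 ^ i := Nat.mul_le_mul_right _ (by norm_num)
        _ = 10 ^ 100 * 32 ^ (i + 1) := by ring

/-- Counters are unary, so a new block size costs about its own length to build. The last one may
exceed `l.length`, but it is `blockRatio i` times a size below `l.length`, which explains the factor
`blockRatio r + 1`. -/
theorem grow_spec {l : List (Val N)} {r : ℕ} (hr : l.length ≤ blockSize r)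
    (hmin : ∀ i < r, blockSize i < l.length) (i : ℕ) (hi : i ≤ r) :
    Call Prog.table 15 (.cons (listVal l) (.cons (countVal N (blockRatio i))
      (.cons (countVal N (blockSize i)) (sizesVal N (blockSizeList i)))))
      (sizesVal N (blockSizeList r))
      ((r - i + 1) * (300 * ((blockRatio r + 1) * (l.length + 1)))) := by
  induction hk : r - i generalizing i with
  | zero =>
    obtain rfl : i = r := by omega
    have hdrop := drop_spec (List.replicate (blockSize i) .nil) l
    rw [List.length_replicate, List.drop_eq_nil_of_le hr] at hdrop
    refine Call.of_wp (body := Prog.grow) rfl ?_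
    simp only [wp, wpVar, wpCase, Prog.grow]
    refine WpCall.intro hdrop ?_
    simp only [listVal_nil]
    refine ⟨trivial, ?_⟩
    have : l.length + 1 ≤ (blockRatio i + 1) * (l.length + 1) :=
      Nat.le_mul_of_pos_left _ (by omega)
    omega
  | succ k ih =>
    have hlt : i < r := by omega
    have hdrop := drop_spec (List.replicate (blockSize i) .nil) l
    rw [List.length_replicate] at hdrop
    obtain ⟨x, l', hx⟩ := List.exists_cons_of_ne_nil (l := l.drop (blockSize i))
      (by simpa [List.drop_eq_nil_iff] using hmin i hlt)
    have hcall := ih (i + 1) (by omega) (by omega)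
    rw [blockRatio_succ, blockSize_succ] at hcall
    have hq : blockRatio i ≤ blockRatio r :=
      Nat.pow_le_pow_right (by norm_num) (by omega)
    refine Call.of_wp (body := Prog.grow) rfl ?_
    simp only [wp, wpVar, wpCase, Prog.grow]
    refine WpCall.intro hdrop ?_
    simp only [hx, listVal_cons]
    refine WpCall.intro (append_countVal_spec _ _) ?_
    refine WpCall.intro (append_countVal_spec _ _) ?_
    refine WpCall.intro (mulCount_spec _ _) ?_
    refine WpCall.intro hcall ⟨rfl, ?_⟩
    have e₁ : (blockRatio i + 1) * (20 * blockSize i + 40) ≤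
        (blockRatio r + 1) * (40 * (l.length + 1)) :=
      Nat.mul_le_mul (by omega) (by have := hmin i hlt; omega)
    have e₂ : l.length + 1 ≤ (blockRatio r + 1) * (l.length + 1) :=
      Nat.le_mul_of_pos_left _ (by omega)
    have e₃ : blockRatio r + 1 ≤ (blockRatio r + 1) * (l.length + 1) :=
      Nat.le_mul_of_pos_right _ (by omega)
    rw [mul_left_comm] at e₁
    rw [add_mul (k + 1) 1, one_mul]
    omega

theorem start_spec (v : Val N) :
    Call Prog.table 25 v
      (.cons (countVal N (blockRatio 0)) (countVal N (blockSize 0))) (10 ^ 100) := by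
  have h : ∀ k, Call Prog.table 14 (.cons (countVal N (2 ^ k)) (countVal N (2 ^ k)))
      (countVal N (2 ^ (k + k))) ((2 ^ k + 1) * (20 * 2 ^ k + 40)) := fun k => by
    rw [pow_add]; exact mulCount_spec _ _
  have e : (.cons .nil (.cons .nil .nil) : Val N) = countVal N (2 ^ 1) := rfl
  refine Call.of_wp (body := Prog.start) rfl ?_
  simp only [wp, wpVar, Prog.start]
  rw [e]
  refine WpCall.intro (h _) ?_
  refine WpCall.intro (h _) ?_
  refine WpCall.intro (h _) ?_
  refine WpCall.intro (h _) ?_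
  refine WpCall.intro (h _) ?_
  refine WpCall.intro (h _) ?_
  refine WpCall.intro (h _) ?_
  refine WpCall.intro (h _) ?_
  refine WpCall.intro (append_countVal_spec _ _) ⟨?_, ?_⟩
  · rw [blockRatio, blockSize, ← two_mul, ← pow_succ']
  · norm_num

end

/-! ### The running time -/

section

variable {N : ℕ}

theorem gPoly_linearPolys {d : ℕ} (b : Fin d → ℕ) :
    gPoly N (linearPolys b) = rootsPoly (List.ofFn fun n => (b n : ZMod N)) := by
  simp [gPoly, linearPolys, rootsPoly, List.map_ofFn, List.prod_ofFn]

theorem rootsList_ofFn {d : ℕ} (b : Fin d → ℕ) :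
    rootsList (List.ofFn fun n => (b n : ZMod N)) =
      List.ofFn fun k : Fin (d + 1) => (gPoly N (linearPolys b)).coeff k := by
  rw [gPoly_linearPolys, rootsList, List.length_ofFn]
  refine List.ext_getElem (by simp [length_coeffList]) fun i _ _ => ?_
  rw [List.getElem_ofFn]
  simp [coeffList]

theorem map_eval_rootsList {d : ℕ} (b s : Fin d → ℕ) :
    ((List.ofFn fun n => (s n : ZMod N)).map
      (ofList (rootsList (List.ofFn fun n => (b n : ZMod N)))).eval) =
      List.ofFn (yValue N (linearPolys b) s) := by
  rw [ofList_rootsList, ← gPoly_linearPolys, List.map_ofFn]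
  rfl

/-- With `x = 2^r`, the multiplication constant contributes `x^5`, and the two factors of order `log
d`, each at most `300 * x^2`, contribute `x^4`; hence `x^9 = 512^r`. -/
theorem cost_bound {d r : ℕ} (hd : 0 < d) :
    10 ^ 100 + 100 + (r + 1) * (300 * ((blockRatio r + 1) * (d + 1))) +
      4 * (10 ^ 100 * 32 ^ r) * (d * ((16 + r) * (16 + r) + 1 + 1)) +
      40 * (10 ^ 100 * 32 ^ r *
        ((d + 1) * (((16 + r) * (16 + r) + 1 + 1) * ((16 + r) * (16 + r) + 1 + 1)))) +
      80 * (d + 1) ≤ 10 ^ 120 * (d * 512 ^ r) := by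
  have hx : r + 1 ≤ 2 ^ r := Nat.lt_two_pow_self
  have e₁ : (32 : ℕ) ^ r = (2 ^ r) ^ 5 := by rw [← pow_mul, mul_comm, pow_mul]; norm_num
  have e₂ : (512 : ℕ) ^ r = (2 ^ r) ^ 9 := by rw [← pow_mul, mul_comm, pow_mul]; norm_num
  have e₃ : blockRatio r = 2 ^ 33 * (2 ^ r) ^ 2 := by rw [blockRatio, pow_add, pow_mul']; ring
  rw [e₁, e₂, e₃]
  generalize 2 ^ r = x at hx
  have hx₁ : 1 ≤ x := by omega
  have hD : (16 + r) * (16 + r) + 1 + 1 ≤ 300 * x ^ 2 := by nlinarith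
  have hd' : d + 1 ≤ 2 * d := by omega
  have pow_le : ∀ k ≤ 9, d * x ^ k ≤ d * x ^ 9 := fun k hk =>
    Nat.mul_le_mul_left _ (Nat.pow_le_pow_right hx₁ hk)
  have h₀ : d ≤ d * x ^ 9 := by simpa using pow_le 0 (by norm_num)
  have h₁ : (r + 1) * (300 * ((2 ^ 33 * x ^ 2 + 1) * (d + 1))) ≤ 600 * 2 ^ 34 * (d * x ^ 9) := by
    calc (r + 1) * (300 * ((2 ^ 33 * x ^ 2 + 1) * (d + 1)))
        ≤ x * (300 * ((2 ^ 33 * x ^ 2 + 2 ^ 33 * x ^ 2) * (2 * d))) := by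
          gcongr
          have := Nat.one_le_pow 2 x hx₁
          omega
      _ = 600 * 2 ^ 34 * (d * x ^ 3) := by ring
      _ ≤ _ := Nat.mul_le_mul_left _ (pow_le 3 (by norm_num))
  have h₂ : 4 * (10 ^ 100 * x ^ 5) * (d * ((16 + r) * (16 + r) + 1 + 1)) ≤
      1200 * 10 ^ 100 * (d * x ^ 9) := by
    calc 4 * (10 ^ 100 * x ^ 5) * (d * ((16 + r) * (16 + r) + 1 + 1))
        ≤ 4 * (10 ^ 100 * x ^ 5) * (d * (300 * x ^ 2)) := by gcongr
      _ = 1200 * 10 ^ 100 * (d * x ^ 7) := by ring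
      _ ≤ _ := Nat.mul_le_mul_left _ (pow_le 7 (by norm_num))
  have h₃ : 40 * (10 ^ 100 * x ^ 5 *
        ((d + 1) * (((16 + r) * (16 + r) + 1 + 1) * ((16 + r) * (16 + r) + 1 + 1)))) ≤
      7200000 * 10 ^ 100 * (d * x ^ 9) := by
    calc _ ≤ 40 * (10 ^ 100 * x ^ 5 * ((2 * d) * ((300 * x ^ 2) * (300 * x ^ 2)))) := by gcongr
      _ = 7200000 * 10 ^ 100 * (d * x ^ 9) := by ring
  omega

theorem factorProgram_runs [NeZero N] {d : ℕ} (b s : Fin d → ℕ) (hd : 0 < d) {r : ℕ}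
    (hr : d ≤ blockSize r) (hmin : ∀ i < r, blockSize i < d) :
    ∃ t, factorProgram.Runs N (inputVal N b s) (resultVal N b s) t ∧
      t ≤ 10 ^ 120 * (d * 512 ^ r) := by
  set bs := List.ofFn fun n => (b n : ZMod N) with hbs
  set ss := List.ofFn fun n => (s n : ZMod N) with hss
  have lb : bs.length = d := List.length_ofFn
  have ls : ss.length = d := List.length_ofFn
  have nb : bs ≠ [] := by rw [← List.length_pos_iff]; omega
  have ns : ss ≠ [] := by rw [← List.length_pos_iff]; omega
  have hB := blockSizes_blockSizeList r
  -- The depth of the trees is the exponent of `blockSize r` plus one, which covers `d + 1`.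
  have hD : d + 1 ≤ 2 ^ ((16 + r) * (16 + r) + 1) := by
    rw [pow_succ]; rw [blockSize] at hr; omega
  have hgrow := grow_spec (l := bs.map Val.num) (r := r) (by simpa [lb]) (by simpa [lb]) 0
    (Nat.zero_le r)
  rw [List.length_map, lb] at hgrow
  have hroots := rootsPoly_spec hB nb (D := (16 + r) * (16 + r) + 1) (by omega) (by omega)
  have hvalues := values_spec hB ns (g := rootsList bs) (by rw [length_rootsList, lb, ls])
    (D := (16 + r) * (16 + r) + 1) (by omega) (by omega)
  rw [map_eval_rootsList, ls] at hvalues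
  rw [lb] at hroots
  have hsearch := searchPoint_spec (N := N) b s 0 (Nat.zero_le d)
  rw [List.drop_zero, List.drop_zero] at hsearch
  have hwp : wp Prog.table Prog.main [inputVal N b s] fun w c => w = resultVal N b s ∧
      c ≤ 10 ^ 120 * (d * 512 ^ r) := by
    simp only [wp, wpVar, wpCase, Prog.main, inputVal, resultVal, encodeList_eq_polyVal,
      ← rootsList_ofFn]
    refine WpCall.intro (start_spec _) ?_
    simp only
    refine WpCall.intro hgrow ?_
    refine WpCall.intro hroots ?_
    refine WpCall.intro hvalues ?_
    refine WpCall.intro hsearch ⟨rfl, ?_⟩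
    refine le_trans ?_ (cost_bound hd)
    rw [Nat.sub_zero, Nat.sub_zero]
    omega
  obtain ⟨_, t, c, hE, htc, rfl, hc⟩ := wp_sound _ hwp
  exact ⟨t, hE, htc.trans hc⟩

theorem exists_minimal_blockSize (d : ℕ) :
    ∃ r, d ≤ blockSize r ∧ ∀ i < r, blockSize i < d := by
  have h : ∃ r, d ≤ blockSize r := ⟨d, by
    refine (Nat.lt_two_pow_self (n := d)).le.trans ?_
    exact Nat.pow_le_pow_right (by norm_num) (by nlinarith)⟩
  classical
  exact ⟨Nat.find h, Nat.find_spec h, fun i hi => not_le.1 (Nat.find_min h hi)⟩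

/-- For `r ≥ 1` the minimality of `r` puts `log₂ d` above a quadratic in `r`, while `log₂ (512^r)`
is linear in `r`. -/
theorem exists_pow_le_rpow {ε : ℝ} (hε : 0 < ε) :
    ∃ C : ℝ, ∀ d r : ℕ, 0 < d → (∀ i < r, blockSize i < d) →
      (512 : ℝ) ^ r ≤ C * (d : ℝ) ^ ε := by
  refine ⟨(2 : ℝ) ^ (81 / (4 * ε)), fun d r hd h => ?_⟩
  have hC : (1 : ℝ) ≤ (2 : ℝ) ^ (81 / (4 * ε)) :=
    Real.one_le_rpow (by norm_num) (by positivity)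
  have hd₁ : (1 : ℝ) ≤ d := by exact_mod_cast hd
  cases r with
  | zero =>
    rw [pow_zero]
    exact one_le_mul_of_one_le_of_one_le hC (Real.one_le_rpow hd₁ hε.le)
  | succ r =>
    have h₁ : (2 : ℝ) ^ (((16 + r) * (16 + r) : ℕ) : ℝ) ≤ d := by
      rw [Real.rpow_natCast]
      exact_mod_cast (h r (Nat.lt_succ_self r)).le
    have h₂ : ((2 : ℝ) ^ (((16 + r) * (16 + r) : ℕ) : ℝ)) ^ ε ≤ (d : ℝ) ^ ε :=
      Real.rpow_le_rpow (by positivity) h₁ hε.le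
    refine le_trans ?_ (mul_le_mul_of_nonneg_left h₂ (by positivity))
    rw [← Real.rpow_mul (by norm_num), ← Real.rpow_add (by norm_num),
      show (512 : ℝ) = 2 ^ 9 by norm_num, ← pow_mul, ← Real.rpow_natCast]
    refine Real.rpow_le_rpow_of_exponent_le (by norm_num) ?_
    push_cast
    -- The constant `81 / (4 * ε)` is the maximum of `9 * t - ε * t^2`, found by completing the
    -- square.
    have h₃ : 9 * ((r : ℝ) + 1) ≤ 81 / (4 * ε) + ((r : ℝ) + 1) ^ 2 * ε := by
      have : 81 / (4 * ε) + ((r : ℝ) + 1) ^ 2 * ε - 9 * ((r : ℝ) + 1) =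
          (2 * ε * ((r : ℝ) + 1) - 9) ^ 2 / (4 * ε) := by field_simp; ring
      have h₄ : 0 ≤ (2 * ε * ((r : ℝ) + 1) - 9) ^ 2 / (4 * ε) := by positivity
      linarith
    have h₅ : ((r : ℝ) + 1) ^ 2 * ε ≤ (16 + r) * (16 + r) * ε := by
      refine mul_le_mul_of_nonneg_right ?_ hε.le
      nlinarith [Nat.cast_nonneg (α := ℝ) r]
    linarith

/-! ### The output on solutions -/

theorem gcd_yValue [NeZero N] {d : ℕ} (b s : Fin d → ℕ) (j : Fin d) :
    Nat.gcd (yValue N (linearPolys b) s j).val N =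
      Int.gcd (∏ n, ((s j : ℤ) - b n)) N := by
  rw [← gcd_val_intCast]
  congr 2
  simp [yValue, gPoly, linearPolys, eval_prod]

theorem gcd_prod_eq_one_iff {d : ℕ} (u : Fin d → ℤ) :
    Int.gcd (∏ n, u n) N = 1 ↔ ∀ n, Int.gcd (u n) N = 1 := by
  simp only [← Int.isCoprime_iff_gcd_eq_one]
  rw [IsCoprime.prod_left_iff]
  simp

/-- An output that is a nontrivial factor of `N`. -/
def IsNontrivialFactor (N : ℕ) (o : Output) : Prop :=
  ∃ k : ℕ, o = Output.factor k ∧ 1 < k ∧ k < N ∧ k ∣ N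

theorem isNontrivialFactor_of_dvd {k : ℕ} (hN : 0 < N) (h : k ∣ N) (h₁ : k ≠ 1) (h₂ : k ≠ N) :
    IsNontrivialFactor N (Output.factor k) := by
  have := Nat.le_of_dvd hN h
  have : k ≠ 0 := by rintro rfl; rw [zero_dvd_iff] at h; omega
  exact ⟨k, rfl, by omega, by omega, h⟩

theorem step6_isNontrivialFactor (hN : 0 < N) {d : ℕ} (f : Fin d → ℤ[X]) (x : ℤ)
    (h₁ : ∀ n, Int.gcd ((f n).eval x) N ≠ N) (i : ℕ)
    (h₂ : ∃ n : Fin d, i ≤ n ∧ Int.gcd ((f n).eval x) N ≠ 1) :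
    IsNontrivialFactor N (step6 N f x i) := by
  obtain ⟨n, hin, hn⟩ := h₂
  induction hk : d - i generalizing i with
  | zero => have := n.2; omega
  | succ k ih =>
    have hlt : i < d := by omega
    rw [step6, dif_pos hlt]
    simp only
    split_ifs with h
    · refine ih (i + 1) (lt_of_le_of_ne hin ?_) (by omega)
      rintro rfl
      exact h.elim hn (h₁ _)
    · push Not at h
      refine isNontrivialFactor_of_dvd hN ?_ h.1 h.2
      exact_mod_cast Int.gcd_dvd_right ((f ⟨i, hlt⟩).eval x) (N : ℤ)

/-- Only the first `j` with `G_j ≠ 1` matters. The condition `G_j ≠ 1` in `h₁` is what later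
supplies an index `i` with `H_i ≠ 1`. -/
theorem step4_isNontrivialFactor (hN : 0 < N) {d : ℕ} (f : Fin d → ℤ[X]) (s : Fin d → ℕ)
    (h₁ : ∀ n, Nat.gcd (yValue N f s n).val N = N →
      Nat.gcd (yValue N f s n).val N ≠ 1 → IsNontrivialFactor N (step6 N f (s n : ℤ) 0)) (j : ℕ)
    (h₂ : ∃ n : Fin d, j ≤ n ∧ Nat.gcd (yValue N f s n).val N ≠ 1) :
    IsNontrivialFactor N (step4 N f s j) := by
  obtain ⟨n, hjn, hn⟩ := h₂
  induction hk : d - j generalizing j with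
  | zero => have := n.2; omega
  | succ k ih =>
    have hlt : j < d := by omega
    rw [step4, dif_pos hlt]
    simp only
    split_ifs with h h'
    · refine ih (j + 1) (lt_of_le_of_ne hjn ?_) (by omega)
      rintro rfl
      exact hn h
    · exact h₁ _ h' h
    · exact isNontrivialFactor_of_dvd hN (Nat.gcd_dvd_right _ _) h h'

theorem step4_eq_errorA {d : ℕ} (f : Fin d → ℤ[X]) (s : Fin d → ℕ)
    (h : ∀ n, Nat.gcd (yValue N f s n).val N = 1) (j : ℕ) : step4 N f s j = Output.errorA := by
  induction hk : d - j generalizing j with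
  | zero => rw [step4, dif_neg (by omega)]
  | succ k ih =>
    rw [step4, dif_pos (show j < d by omega)]
    simp only
    rw [if_pos (h _)]
    exact ih (j + 1) (by omega)

theorem IsSolution.pos {d : ℕ} {b s : Fin d → ℕ} (h : IsSolution N b s) (hd : 0 < d) : 0 < N :=
  (Nat.zero_le _).trans_lt (h.base_lt ⟨0, hd⟩)

/-- Both numbers lie in `Z_N`, so their difference has absolute value below `N`; divisibility by `N`
would force `b_i = s_j`, against disjointness. -/
theorem IsSolution.gcd_ne {d : ℕ} {b s : Fin d → ℕ} (h : IsSolution N b s) (i j : Fin d) :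
    Int.gcd ((s j : ℤ) - b i) N ≠ N := by
  intro e
  have h₁ : (N : ℤ) ∣ (s j : ℤ) - b i := by
    rw [← Int.gcd_eq_right_iff_dvd (Nat.cast_nonneg N)]
    exact_mod_cast e
  have h₂ := h.base_lt i
  have h₃ := h.point_lt j
  have h₄ := Int.eq_zero_of_abs_lt_dvd h₁ (by rw [abs_lt]; constructor <;> omega)
  exact Set.disjoint_left.1 h.disjoint ⟨i, rfl⟩ ⟨j, by omega⟩

theorem IsSolution.output_of_prime {d : ℕ} {b s : Fin d → ℕ} (h : IsSolution N b s)
    (hN : N.Prime) : output N (linearPolys b) s = Output.errorA := by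
  have : NeZero N := ⟨hN.ne_zero⟩
  refine step4_eq_errorA _ _ (fun j => ?_) 0
  rw [gcd_yValue, gcd_prod_eq_one_iff]
  intro i
  have hdvd : Int.gcd ((s j : ℤ) - b i) N ∣ N := by
    exact_mod_cast Int.gcd_dvd_right ((s j : ℤ) - b i) (N : ℤ)
  exact ((Nat.dvd_prime hN).1 hdvd).resolve_right (h.gcd_ne i j)

theorem IsSolution.output_of_isComposite {d : ℕ} {b s : Fin d → ℕ} (h : IsSolution N b s)
    (hd : 0 < d) (hN : IsComposite N) : IsNontrivialFactor N (output N (linearPolys b) s) := by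
  have hpos := h.pos hd
  have : NeZero N := ⟨hpos.ne'⟩
  refine step4_isNontrivialFactor hpos _ _ (fun j _ hj => ?_) 0 ?_
  · rw [gcd_yValue, Ne, gcd_prod_eq_one_iff, not_forall] at hj
    obtain ⟨i, hi⟩ := hj
    refine step6_isNontrivialFactor hpos _ _ (fun n => ?_) 0 ⟨i, Nat.zero_le _, ?_⟩
    · rw [eval_linearPolys]; exact h.gcd_ne n j
    · rwa [eval_linearPolys]
  · obtain ⟨i, j, p, hp, hpN, hij⟩ := h.congr hN
    refine ⟨j, Nat.zero_le _, ?_⟩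
    rw [gcd_yValue, Ne, gcd_prod_eq_one_iff, not_forall]
    refine ⟨i, fun e => hp.one_lt.ne' ?_⟩
    have h₁ : (p : ℤ) ∣ Int.gcd ((s j : ℤ) - b i) N :=
      Int.dvd_coe_gcd hij.dvd (by exact_mod_cast hpN)
    rw [e] at h₁
    exact Nat.dvd_one.1 (by exact_mod_cast h₁)

end

end DigitFactor

/-! ### The theorem, from the running time and the output on solutions. -/

theorem mainTheorem1 :
    (∃ P : DigitFactor.Program, P.Implements ∧
      ∀ ε : ℝ, 0 < ε → ∃ C : ℝ, ∀ (N d : ℕ) (b s : Fin d → ℕ), 0 < d →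
        DigitFactor.IsSolution N b s →
        ∃ t : ℕ, P.Runs N (DigitFactor.inputVal N b s) (DigitFactor.resultVal N b s) t ∧
          (t : ℝ) ≤ C * (d : ℝ) ^ (1 + ε)) ∧
    ∀ (N d : ℕ) (b s : Fin d → ℕ), 0 < d → DigitFactor.IsSolution N b s →
      (DigitFactor.IsComposite N →
        ∃ k : ℕ, DigitFactor.output N (DigitFactor.linearPolys b) s =
            DigitFactor.Output.factor k ∧ 1 < k ∧ k < N ∧ k ∣ N) ∧
      (N.Prime →
        DigitFactor.output N (DigitFactor.linearPolys b) s = DigitFactor.Output.errorA) := by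
  refine ⟨⟨DigitFactor.factorProgram, ?_, ?_⟩, fun N d b s hd h =>
    ⟨fun hN => h.output_of_isComposite hd hN, h.output_of_prime⟩⟩
  · intro N d b s hN hd _ _
    have : NeZero N := ⟨hN.ne'⟩
    obtain ⟨r, hr, hmin⟩ := DigitFactor.exists_minimal_blockSize d
    obtain ⟨t, ht, -⟩ := DigitFactor.factorProgram_runs (N := N) b s hd hr hmin
    exact ⟨t, ht⟩
  · intro ε hε
    obtain ⟨C, hC⟩ := DigitFactor.exists_pow_le_rpow hε
    refine ⟨10 ^ 120 * C, fun N d b s hd h => ?_⟩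
    have : NeZero N := ⟨(h.pos hd).ne'⟩
    obtain ⟨r, hr, hmin⟩ := DigitFactor.exists_minimal_blockSize d
    obtain ⟨t, ht, hle⟩ := DigitFactor.factorProgram_runs (N := N) b s hd hr hmin
    refine ⟨t, ht, ?_⟩
    have hd' : (0 : ℝ) < d := by exact_mod_cast hd
    calc (t : ℝ) ≤ 10 ^ 120 * (d * 512 ^ r) := by exact_mod_cast hle
      _ ≤ 10 ^ 120 * (d * (C * (d : ℝ) ^ ε)) := by gcongr; exact hC d r hd hmin
      _ = 10 ^ 120 * C * (d : ℝ) ^ (1 + ε) := by rw [Real.rpow_add hd', Real.rpow_one]; ring
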